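/- A TH-pentagon is a plane region congruent (reflections allowed) to the convex pentagon $ABCDE$ obtained by joining equilateral triangles $ABD$ and $BCD$ of side length $1$ along $BD$, on opposite sides of $BD$, with an isosceles triangle $ADE$ with base $AD$ and $\angle E = 120^\circ$, lying on the other side of $AD$ from $B$. Thus $AB=BC=CD=1$, $DE=EA=1/\sqrt3$, and the angles at $A,B,C,D,E$ are $90^\circ,120^\circ,60^\circ,150^\circ,120^\circ$. The windmill unit is the union of the three rotations of $ABCDE$ about $E$ through multiples of $120^\circ$. The HFL1-unit is the union of the six rotations of the windmill unit about its vertex $C$ (that of the pentagon $ABCDE$) through multiples of $60^\circ$; it is an 18-gon all of whose sides have length $1$. For a real number $s>0$, a hexagonal flower with side length $s$ is a plane region similar to the HFL1-unit with ratio $s$. A region is filled by TH-pentagons if it is the union of finitely many TH-pentagons with pairwise disjoint interiors; the tiling is not required to be edge-to-edge. Then no hexagonal flower with side length $s\ge 4$ can be filled by TH-pentagons, whereas every hexagonal flower with side length $1$, $2$ or $3$ can be filled by TH-pentagons. -/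

import Mathlib

namespace THTiling

/-- Vertex `A` of the TH-pentagon.  The equilateral triangle `ABD` has side length one. -/
noncomputable def vA : ℂ := 0

/-- Vertex `B`: `ABD` is an equilateral triangle. -/
noncomputable def vB : ℂ := ⟨1 / 2, -(√3 / 2)⟩

/-- Vertex `C`: `BCD` is an equilateral triangle on the other side of `BD`. -/
noncomputable def vC : ℂ := ⟨3 / 2, -(√3 / 2)⟩

/-- Vertex `D`. -/
noncomputable def vD : ℂ := 1

/-- Vertex `E`: `ADE` is an isosceles triangle with base `AD` and apex angle 120 degrees, lying on
the other side of `AD` from `B`; its area is one third of the area of `ABD`. -/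
noncomputable def vE : ℂ := ⟨1 / 2, √3 / 6⟩

/-- The TH-pentagon `ABCDE` (a closed convex region) with `AB = BC = CD = 1` and
`DE = EA = 1 / √3`; its angles at `A, B, C, D, E` are 90, 120, 60, 150, 120 degrees. -/
noncomputable def thPentagon : Set ℂ := convexHull ℝ {vA, vB, vC, vD, vE}

/-- Counterclockwise rotation of the plane about the point `c` through the angle `θ`. -/
noncomputable def rotateAbout (c : ℂ) (θ : ℝ) (z : ℂ) : ℂ :=
  c + Complex.exp (θ * Complex.I) * (z - c)

/-- The windmill unit: the three rotations of the TH-pentagon about its vertex `E` through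
multiples of 120 degrees (three angles `E`, each of 120 degrees, meet at that point). -/
noncomputable def windmillUnit : Set ℂ :=
  ⋃ k : Fin 3, rotateAbout vE (((k : ℕ) : ℝ) * (2 * Real.pi / 3)) '' thPentagon

/-- The hexagonal flowers L1 unit (HFL1-unit): the six rotations of the windmill unit about a
vertex `C` through multiples of 60 degrees (six angles `C`, each of 60 degrees, meet there). -/
noncomputable def hfl1Unit : Set ℂ :=
  ⋃ k : Fin 6, rotateAbout vC (((k : ℕ) : ℝ) * (Real.pi / 3)) '' windmillUnit

/-- `X` is a hexagonal flower with side length `s`, that is, similar to the HFL1-unit with ratio of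
similitude `s` (all the sides of the HFL1-unit have length one). -/
def IsHexagonalFlower (s : ℝ) (X : Set ℂ) : Prop :=
  ∃ f : ℂ → ℂ, (∀ x y : ℂ, dist (f x) (f y) = s * dist x y) ∧ X = f '' hfl1Unit

/-- `X` can be filled by TH-pentagons: it is the union of finitely many congruent copies of the
TH-pentagon (reflections are allowed) whose interiors are pairwise disjoint. -/
def FilledByTHPentagons (X : Set ℂ) : Prop :=
  ∃ (n : ℕ) (f : Fin n → (ℂ ≃ᵢ ℂ)),
    (Pairwise fun i j : Fin n =>
      Disjoint (interior (f i '' thPentagon)) (interior (f j '' thPentagon))) ∧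
    ⋃ i : Fin n, f i '' thPentagon = X

end THTiling

/-! Put the flower so that one outer side is the segment from 0 to `s` and an outer hexagon stands
on it (`FlowerRegion`), and suppose that it is tiled with `s ≥ 4`. All angles of the pentagon are
multiples of 30°. A tile with an edge starting at a point of (1/3)ℤ[ζ], ζ = exp(πi/6), in a
direction `ζ ^ k` has all its vertices in (1/3)ℤ[ζ]. If a ray of this kind has a filled sector on
its right and a part of the region on its left, some tile has an edge along it. If moreover an
obstacle on the left keeps `p` from being interior to that edge, the edge starts at `p`, and only
ten tiles are possible (`edge_along_ray`, `options_mem`). This gives a finite branching search that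
never assumes the tiling to be edge-to-edge. `Problem.run` checks an explicit search tree by exact
arithmetic with numbers `m + n √3`, and `Problem.run_sound` turns it into the existence of a tile.

The searches force an angle `B` into the corner at 0, and the next tile on the side must have `B` at
1, with its edge `BC` or `BA` on the side. A vertex `D` on the side would leave a gap of 30°, less
than any angle. If `BC` comes second, it repeats up to the right end and conflicts with the mirror
image of the first tile, which symmetry forces there (`not_known_BC_one`). If `BA` comes second,
four tiles are forced on the segment from 0 to 4, the last one with `B` at 4. For `4 < s < 5` it
overlaps the tile at the right end; for `s ≥ 5` there is no continuation. For `s = 4` the search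
climbs the left side and puts an angle `D` of 150° into the reentrant corner of 240° at its end. The
reflection through that corner gives a second such angle, which overlaps the first although the two
tiles differ.

For sides 1, 2, 3 explicit tilings with sixfold symmetry are given. A tile consists of two unit
lattice triangles and a third of another one, so covering and disjointness become a finite check
plus a count of thirds (`covers_sound`, `nodup_of_covers`). -/

open Complex ComplexConjugate Filter Topology

namespace THTiling

/-! ### Exact arithmetic in the cyclotomic lattice -/

/-- The primitive twelfth root of unity `exp (π i / 6)`. -/
noncomputable def zeta : ℂ := ⟨√3 / 2, 1 / 2⟩

/-- An element `(a + b ζ + c ζ² + d ζ³) / 3` of the cyclotomic lattice, given by its coordinates. -/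
structure Cyc where
  a : ℤ
  b : ℤ
  c : ℤ
  d : ℤ
deriving DecidableEq

namespace Cyc

/-- The complex number represented by a lattice element. -/
noncomputable def toC (p : Cyc) : ℂ :=
  ⟨(p.a + p.c / 2 + p.b * (√3 / 2)) / 3, (p.b / 2 + p.d + p.c * (√3 / 2)) / 3⟩

def add (p q : Cyc) : Cyc := ⟨p.a + q.a, p.b + q.b, p.c + q.c, p.d + q.d⟩

def sub (p q : Cyc) : Cyc := ⟨p.a - q.a, p.b - q.b, p.c - q.c, p.d - q.d⟩

/-- Multiplication by `ζ`. -/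
def rotOne (p : Cyc) : Cyc := ⟨-p.d, p.a, p.b + p.d, p.c⟩

/-- Multiplication by `ζ ^ k`. -/
def rot : ℕ → Cyc → Cyc
  | 0, p => p
  | k + 1, p => rotOne (rot k p)

/-- The imaginary part of `p` is `(m + n √3) / 6`. -/
def imPair (p : Cyc) : ℤ × ℤ := (p.b + 2 * p.d, p.c)

theorem toC_add (p q : Cyc) : (p.add q).toC = p.toC + q.toC := by
  apply Complex.ext <;> simp [toC, add] <;> ring

theorem toC_sub (p q : Cyc) : (p.sub q).toC = p.toC - q.toC := by
  apply Complex.ext <;> simp [toC, sub] <;> ring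

theorem toC_rotOne (p : Cyc) : (rotOne p).toC = zeta * p.toC := by
  have h : √3 * √3 = (3 : ℝ) := Real.mul_self_sqrt (by norm_num)
  apply Complex.ext
  · simp [toC, rotOne, zeta]; linear_combination (-(p.c : ℝ)/12 + p.c/12 - (p.b : ℝ)/12) * h
  · simp [toC, rotOne, zeta]; linear_combination (-(p.c : ℝ)/12) * h

theorem toC_rot (k : ℕ) (p : Cyc) : (rot k p).toC = zeta ^ k * p.toC := by
  induction k with
  | zero => simp [rot]
  | succ k ih => rw [rot, toC_rotOne, ih, pow_succ]; ring

theorem im_toC (p : Cyc) : p.toC.im = (p.imPair.1 + p.imPair.2 * √3) / 6 := by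
  simp [toC, imPair]; ring

end Cyc

/-- Positivity of `m + n √3`. -/
def posRt (x : ℤ × ℤ) : Bool :=
  if 0 ≤ x.1 then (if 0 ≤ x.2 then decide (0 < x.1 + x.2) else decide (3 * (x.2 * x.2) < x.1 * x.1))
  else (if 0 ≤ x.2 then decide (x.1 * x.1 < 3 * (x.2 * x.2)) else false)

def zeroRt (x : ℤ × ℤ) : Bool := decide (x.1 = 0) && decide (x.2 = 0)

/-- When `m` and `n` have opposite signs, `m² - 3n² = (m + n√3)(m - n√3)`, and the conjugate factor
has a known sign; so comparing squares decides the question within the integers. -/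
theorem posRt_iff (x : ℤ × ℤ) : posRt x = true ↔ 0 < (x.1 + x.2 * √3 : ℝ) := by
  obtain ⟨m, n⟩ := x
  have h3 : √3 * √3 = (3 : ℝ) := Real.mul_self_sqrt (by norm_num)
  have hp : 0 < √3 := by positivity
  have h1 : (1:ℝ) < √3 := by
    rw [Real.lt_sqrt] <;> norm_num
  unfold posRt
  simp only
  split_ifs with hm hn hn
  · have hm' : (0:ℝ) ≤ m := by exact_mod_cast hm
    have hn' : (0:ℝ) ≤ n := by exact_mod_cast hn
    simp only [decide_eq_true_eq]
    constructor
    · intro h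
      have : (0:ℝ) < m + n := by exact_mod_cast h
      nlinarith
    · intro h
      by_contra hc
      have h0 : m = 0 := by omega
      have h0' : n = 0 := by omega
      simp [h0, h0'] at h
  · have hm' : (0:ℝ) ≤ m := by exact_mod_cast hm
    have hn' : (n:ℝ) < 0 := by exact_mod_cast (not_le.mp hn)
    have e : (3 * (n * n) < m * m) ↔ ((3:ℝ) * (n * n) < m * m) := by exact_mod_cast Iff.rfl
    simp only [decide_eq_true_eq, e]
    have key : (m:ℝ) * m - 3 * (n * n) = (m + n * √3) * (m - n * √3) := by
      linear_combination (n*n : ℝ) * h3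
    have hpos : 0 < (m:ℝ) - n * √3 := by nlinarith
    constructor
    · intro h
      by_contra hc
      nlinarith [mul_nonneg (sub_nonneg.mpr (not_lt.mp hc)) hpos.le]
    · intro h
      nlinarith [mul_pos h hpos]
  · have hm' : (m:ℝ) < 0 := by exact_mod_cast (not_le.mp hm)
    have hn' : (0:ℝ) ≤ n := by exact_mod_cast hn
    have e : (m * m < 3 * (n * n)) ↔ ((m * m : ℝ) < 3 * (n * n)) := by exact_mod_cast Iff.rfl
    simp only [decide_eq_true_eq, e]
    have key : 3 * (n * n) - (m:ℝ) * m = (m + n * √3) * (n * √3 - m) := by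
      linear_combination (-(n*n : ℝ)) * h3
    have hpos : 0 < n * √3 - (m:ℝ) := by nlinarith
    constructor
    · intro h
      by_contra hc
      nlinarith [mul_nonneg (sub_nonneg.mpr (not_lt.mp hc)) hpos.le]
    · intro h
      nlinarith [mul_pos h hpos]
  · have hm' : (m:ℝ) < 0 := by exact_mod_cast (not_le.mp hm)
    have hn' : (n:ℝ) < 0 := by exact_mod_cast (not_le.mp hn)
    simp only [false_iff, not_lt]
    nlinarith

theorem zeroRt_iff (x : ℤ × ℤ) : zeroRt x = true ↔ (x.1 + x.2 * √3 : ℝ) = 0 := by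
  obtain ⟨m, n⟩ := x
  simp only [zeroRt, Bool.and_eq_true, decide_eq_true_eq]
  constructor
  · rintro ⟨rfl, rfl⟩; simp
  · intro h
    have h1 := (posRt_iff (m, n)).not.mpr (by simp [h])
    have h2 := (posRt_iff (-m, -n)).not.mpr (by simp; linarith)
    unfold posRt at h1 h2
    simp only at h1 h2
    by_cases hn : n = 0
    · subst hn; simp at h; exact ⟨h, rfl⟩
    · exfalso
      have irr : Irrational √3 := by
        have := Nat.Prime.irrational_sqrt (p := 3) (by norm_num)
        simpa using this
      apply irr
      refine ⟨-m / n, ?_⟩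
      push_cast
      have : (n:ℝ) ≠ 0 := by exact_mod_cast hn
      field_simp
      linarith

theorem conj_zeta_mul : conj zeta * zeta = 1 := by
  have h : √3 * √3 = (3 : ℝ) := Real.mul_self_sqrt (by norm_num)
  apply Complex.ext <;> simp [zeta] <;> linarith

theorem zeta_cubed : zeta ^ 3 = I := by
  have h : √3 * √3 = (3 : ℝ) := Real.mul_self_sqrt (by norm_num)
  apply Complex.ext
  · simp [zeta, pow_succ]; linear_combination (√3 / 8) * h
  · simp [zeta, pow_succ]; ring_nf; simp; norm_num

theorem zeta_pow_twelve : zeta ^ 12 = 1 := by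
  have : zeta ^ 12 = (zeta ^ 3) ^ 4 := by ring
  rw [this, zeta_cubed, I_pow_four]

theorem zeta_ne_zero : zeta ≠ 0 := by
  intro h; have := conj_zeta_mul; simp [h] at this

theorem conj_zeta : conj zeta = zeta ^ 11 := by
  have := zeta_pow_twelve
  have h : conj zeta * zeta = zeta ^ 11 * zeta := by rw [conj_zeta_mul, ← pow_succ, this]
  exact mul_right_cancel₀ zeta_ne_zero h

theorem zeta_pow_mod (n : ℕ) : zeta ^ (n % 12) = zeta ^ n := by
  conv_rhs => rw [← Nat.div_add_mod n 12, pow_add, pow_mul, zeta_pow_twelve, one_pow, one_mul]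

theorem conj_zeta_pow (n : ℕ) : conj (zeta ^ n) = zeta ^ (11 * n) := by
  rw [map_pow, conj_zeta, pow_mul]

theorem norm_zeta : ‖zeta‖ = 1 := by
  have h := congrArg norm conj_zeta_mul
  simp at h
  nlinarith [norm_nonneg zeta]

theorem norm_zeta_pow (n : ℕ) : ‖zeta ^ n‖ = 1 := by simp [norm_zeta]

theorem conj_mul_self_of_norm {a : ℂ} (h : ‖a‖ = 1) : conj a * a = 1 := by
  rw [← Complex.normSq_eq_conj_mul_self, Complex.normSq_eq_norm_sq, h]; simp

/-! ### Half-planes and local tests at a lattice point -/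

/-- A closed half-plane: the points on the left of the line through `h.1` with direction
`ζ ^ h.2`. -/
abbrev HalfPlane := Cyc × ℕ

/-- A convex region given by half-planes. -/
abbrev Poly := List HalfPlane

/-- Signed distance of `z` from the boundary line of a half-plane. -/
noncomputable def sd (h : HalfPlane) (z : ℂ) : ℝ := (conj (zeta ^ h.2) * (z - h.1.toC)).im

/-- The rate of change of `sd` in direction `v`. -/
noncomputable def dirIm (d : ℕ) (v : ℂ) : ℝ := (conj (zeta ^ d) * v).im

/-- The imaginary part of `ζ ^ j p` is `(m + n √3) / 6` for the pair `(m, n)`, for `j < 12`. -/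
def rotImPair (j : ℕ) (p : Cyc) : ℤ × ℤ :=
  match j with
  | 0 => (p.b + 2 * p.d, p.c)
  | 1 => (p.a + 2 * p.c, p.b + p.d)
  | 2 => (2 * p.b + p.d, p.a + p.c)
  | 3 => (2 * p.a + p.c, p.b)
  | 4 => (p.b - p.d, p.a)
  | 5 => (p.a - p.c, -p.d)
  | 6 => (-p.b - 2 * p.d, -p.c)
  | 7 => (-p.a - 2 * p.c, -p.b - p.d)
  | 8 => (-2 * p.b - p.d, -p.a - p.c)
  | 9 => (-2 * p.a - p.c, -p.b)
  | 10 => (p.d - p.b, -p.a)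
  | _ => (p.c - p.a, p.d)

theorem rotImPair_eq {j : ℕ} (hj : j < 12) (p : Cyc) : rotImPair j p = (Cyc.rot j p).imPair := by
  interval_cases j <;> simp [rotImPair, Cyc.rot, Cyc.rotOne, Cyc.imPair] <;>
    omega

/-- The factor 11 inverts the rotation, since the conjugate of `ζ` is `ζ ^ 11`. The signed distance
is this pair, read as `m + n √3`, divided by 6. -/
def sdPair (h : HalfPlane) (p : Cyc) : ℤ × ℤ := rotImPair ((11 * h.2) % 12) (p.sub h.1)

/-- The bisector of the directions `ζ ^ k` and `ζ ^ (k + 1)`. -/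
noncomputable def bis (k : ℕ) : ℂ := zeta ^ k + zeta ^ (k + 1)

theorem sd_toC (h : HalfPlane) (p : Cyc) :
    sd h p.toC = ((sdPair h p).1 + (sdPair h p).2 * √3) / 6 := by
  rw [sdPair, rotImPair_eq (Nat.mod_lt _ (by norm_num)), ← Cyc.im_toC, Cyc.toC_rot, zeta_pow_mod, Cyc.toC_sub, sd, conj_zeta_pow]

theorem sd_pos_iff (h : HalfPlane) (p : Cyc) : posRt (sdPair h p) = true ↔ 0 < sd h p.toC := by
  rw [sd_toC, posRt_iff]
  constructor <;> intro h <;> linarith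

theorem sd_zero_iff (h : HalfPlane) (p : Cyc) : zeroRt (sdPair h p) = true ↔ sd h p.toC = 0 := by
  rw [sd_toC, zeroRt_iff]
  constructor <;> intro h <;> linarith

theorem sd_add_mul (h : HalfPlane) (z v : ℂ) (r : ℝ) :
    sd h (z + r * v) = sd h z + r * dirIm h.2 v := by
  simp only [sd, dirIm]
  have : conj (zeta ^ h.2) * (z + r * v - h.1.toC)
      = conj (zeta ^ h.2) * (z - h.1.toC) + (r : ℂ) * (conj (zeta ^ h.2) * v) := by ring
  rw [this, add_im, im_ofReal_mul]

theorem dirIm_add (d : ℕ) (v w : ℂ) : dirIm d (v + w) = dirIm d v + dirIm d w := by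
  simp only [dirIm, mul_add, add_im]

theorem dirIm_real_mul (d : ℕ) (r : ℝ) (v : ℂ) : dirIm d (r * v) = r * dirIm d v := by
  simp only [dirIm]
  rw [mul_left_comm, im_ofReal_mul]

/-- The angle, in units of 30 degrees, from direction `d` to direction `k`. -/
def ang (d k : ℕ) : ℕ := (k + 11 * d) % 12

theorem dirIm_zeta_pow (d k : ℕ) : dirIm d (zeta ^ k) = (zeta ^ ang d k).im := by
  rw [dirIm, conj_zeta_pow, ← pow_add, ang, zeta_pow_mod, add_comm]

theorem dirIm_bis (d k : ℕ) : dirIm d (bis k) = (zeta ^ ang d k + zeta ^ (ang d k + 1)).im := by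
  rw [dirIm, bis, conj_zeta_pow, mul_add, ← pow_add, ← pow_add, pow_succ zeta (ang d k), ang,
    zeta_pow_mod, add_comm (11 * d), ← pow_succ, show 11 * d + (k + 1) = k + 11 * d + 1 by ring]

theorem zeta_pow_eq_toC (j : ℕ) : zeta ^ j = (Cyc.rot j ⟨3, 0, 0, 0⟩).toC := by
  rw [Cyc.toC_rot]
  have : (Cyc.toC ⟨3, 0, 0, 0⟩) = 1 := by apply Complex.ext <;> simp [Cyc.toC]
  rw [this, mul_one]

theorem im_toC_pos_iff (p : Cyc) : 0 < p.toC.im ↔ posRt p.imPair = true := by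
  rw [posRt_iff, Cyc.im_toC]; constructor <;> intro h <;> linarith

theorem im_toC_zero_iff (p : Cyc) : p.toC.im = 0 ↔ zeroRt p.imPair = true := by
  rw [zeroRt_iff, Cyc.im_toC]; constructor <;> intro h <;> linarith

theorem ang_lt (d k : ℕ) : ang d k < 12 := Nat.mod_lt _ (by norm_num)

/-- Bisectors point in odd multiples of 15° and are never parallel to an edge line. A sector of 30°
between consecutive directions lies on one side of every line through its apex with direction `ζ ^
d`, so testing its bisector decides the whole sector. -/
theorem dirIm_bis_pos_iff (d k : ℕ) : 0 < dirIm d (bis k) ↔ ang d k < 6 := by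
  rw [dirIm_bis, zeta_pow_eq_toC, zeta_pow_eq_toC, ← Cyc.toC_add, im_toC_pos_iff]
  have : ∀ j < 12, posRt ((Cyc.rot j ⟨3, 0, 0, 0⟩).add (Cyc.rot (j + 1) ⟨3, 0, 0, 0⟩)).imPair = true
      ↔ j < 6 := by decide
  exact this _ (ang_lt d k)

theorem dirIm_bis_ne_zero (d k : ℕ) : dirIm d (bis k) ≠ 0 := by
  rw [dirIm_bis, zeta_pow_eq_toC, zeta_pow_eq_toC, ← Cyc.toC_add, Ne, im_toC_zero_iff]
  have : ∀ j < 12, ¬ zeroRt ((Cyc.rot j ⟨3, 0, 0, 0⟩).add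
      (Cyc.rot (j + 1) ⟨3, 0, 0, 0⟩)).imPair = true := by decide
  exact this _ (ang_lt d k)

theorem dirIm_zeta_pow_pos_iff (d k : ℕ) : 0 < dirIm d (zeta ^ k) ↔ 0 < ang d k ∧ ang d k < 6 := by
  rw [dirIm_zeta_pow, zeta_pow_eq_toC, im_toC_pos_iff]
  have : ∀ j < 12, posRt (Cyc.rot j ⟨3, 0, 0, 0⟩).imPair = true ↔ 0 < j ∧ j < 6 := by decide
  exact this _ (ang_lt d k)

theorem dirIm_zeta_pow_zero_iff (d k : ℕ) :
    dirIm d (zeta ^ k) = 0 ↔ ang d k = 0 ∨ ang d k = 6 := by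
  rw [dirIm_zeta_pow, zeta_pow_eq_toC, im_toC_zero_iff]
  have : ∀ j < 12, zeroRt (Cyc.rot j ⟨3, 0, 0, 0⟩).imPair = true ↔ j = 0 ∨ j = 6 := by decide
  exact this _ (ang_lt d k)

theorem dirIm_zeta_pow_nonneg_iff (d k : ℕ) : 0 ≤ dirIm d (zeta ^ k) ↔ ang d k ≤ 6 := by
  rw [le_iff_lt_or_eq, dirIm_zeta_pow_pos_iff, eq_comm, dirIm_zeta_pow_zero_iff]
  omega

/-- The closed region. -/
def Poly.closed (P : Poly) : Set ℂ := {z | ∀ h ∈ P, 0 ≤ sd h z}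

/-- The open region. -/
def Poly.inner (P : Poly) : Set ℂ := {z | ∀ h ∈ P, 0 < sd h z}

/-- The points near `p` in direction `bis k` are in the open region. -/
def occ (P : Poly) (p : Cyc) (k : ℕ) : Bool :=
  P.all fun h => posRt (sdPair h p) || (zeroRt (sdPair h p) && decide (ang h.2 k < 6))

/-- `ζ ^ k` is in the closed tangent cone at `p`. -/
def closedDir (P : Poly) (p : Cyc) (k : ℕ) : Bool :=
  P.all fun h => posRt (sdPair h p) || (zeroRt (sdPair h p) && decide (ang h.2 k ≤ 6))

open Filter Topology

/-- First-order expansion: for small `r` the sign of `s + r d` is that of `s`, or of `d` if `s`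
vanishes. All local statements about polygons reduce to this. -/
theorem eventually_pos_of_lex {s d : ℝ} (h : 0 < s ∨ (s = 0 ∧ 0 < d)) :
    ∀ᶠ r : ℝ in 𝓝[>] 0, 0 < s + r * d := by
  rcases h with h | ⟨rfl, h⟩
  · have : Tendsto (fun r : ℝ => s + r * d) (𝓝[>] 0) (𝓝 (s + 0 * d)) :=
      ((by fun_prop : Continuous fun r : ℝ => s + r * d).tendsto 0).mono_left nhdsWithin_le_nhds
    rw [zero_mul, add_zero] at this
    exact this.eventually (lt_mem_nhds h)
  · filter_upwards [self_mem_nhdsWithin] with r hr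
    have : 0 < r * d := mul_pos hr h
    linarith

theorem eventually_neg_of_neg {s d : ℝ} (h : s < 0) :
    ∀ᶠ r : ℝ in 𝓝[>] 0, s + r * d < 0 := by
  have := eventually_pos_of_lex (s := -s) (d := -d) (Or.inl (by linarith))
  filter_upwards [this] with r hr
  linarith

theorem eventually_all_list {α β : Type*} {l : Filter α} (L : List β) {p : β → α → Prop}
    (h : ∀ b ∈ L, ∀ᶠ x in l, p b x) : ∀ᶠ x in l, ∀ b ∈ L, p b x := by
  induction L with
  | nil => simp
  | cons b L ih =>
    have h1 := h b (by simp)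
    have h2 := ih fun c hc => h c (by simp [hc])
    filter_upwards [h1, h2] with x hx1 hx2 c hc
    rcases List.mem_cons.mp hc with rfl | hc
    · exact hx1
    · exact hx2 c hc

theorem occ_sound {P : Poly} {p : Cyc} {k : ℕ} (h : occ P p k = true) :
    ∀ᶠ r : ℝ in 𝓝[>] 0, p.toC + r * bis k ∈ P.inner := by
  apply eventually_all_list
  intro b hb
  simp only [occ, List.all_eq_true, Bool.or_eq_true, Bool.and_eq_true, decide_eq_true_eq] at h
  have := h b hb
  rw [sd_pos_iff, sd_zero_iff, ← dirIm_bis_pos_iff] at this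
  filter_upwards [eventually_pos_of_lex this] with r hr
  rwa [sd_add_mul]

theorem not_occ_sound {P : Poly} {p : Cyc} {k : ℕ} (h : occ P p k = false) :
    ∀ᶠ r : ℝ in 𝓝[>] 0, p.toC + r * bis k ∉ P.closed := by
  simp only [occ, List.all_eq_false, Bool.or_eq_true, Bool.and_eq_true, decide_eq_true_eq] at h
  obtain ⟨b, hb, hn⟩ := h
  rw [sd_pos_iff, sd_zero_iff, ← dirIm_bis_pos_iff] at hn
  push Not at hn
  have hle := hn.1
  rcases lt_or_eq_of_le hle with hlt | heq
  · filter_upwards [eventually_neg_of_neg (d := dirIm b.2 (bis k)) hlt] with r hr hm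
    have := hm b hb
    rw [sd_add_mul] at this
    linarith
  · have h1 := lt_of_le_of_ne (hn.2 heq) (dirIm_bis_ne_zero _ _)
    filter_upwards [self_mem_nhdsWithin] with r hr hm
    have h2 := hm b hb
    rw [sd_add_mul, heq] at h2
    have : r * dirIm b.2 (bis k) < 0 := mul_neg_of_pos_of_neg hr h1
    linarith

/-- The sector between `ζ ^ k` and `bis m`, close to `ζ ^ k`, is in the open region. -/
theorem closedDir_sound {P : Poly} {p : Cyc} {k m : ℕ} (h : closedDir P p k = true)
    (h' : occ P p m = true) {η : ℝ} (hη : 0 < η) :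
    ∀ᶠ r : ℝ in 𝓝[>] 0, p.toC + r * (zeta ^ k + η * bis m) ∈ P.inner := by
  apply eventually_all_list
  intro b hb
  simp only [occ, closedDir, List.all_eq_true, Bool.or_eq_true, Bool.and_eq_true,
    decide_eq_true_eq] at h h'
  have h1 := h b hb
  have h2 := h' b hb
  rw [sd_pos_iff, sd_zero_iff, ← dirIm_zeta_pow_nonneg_iff] at h1
  rw [sd_pos_iff, sd_zero_iff, ← dirIm_bis_pos_iff] at h2
  -- A direction in the closed tangent cone plus a positive multiple of one in the open cone lies in
  -- the open cone.
  have : 0 < sd b p.toC ∨ (sd b p.toC = 0 ∧ 0 < dirIm b.2 (zeta ^ k + η * bis m)) := by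
    rcases h1 with h1 | h1
    · exact Or.inl h1
    · rcases h2 with h2 | h2
      · exact Or.inl h2
      · refine Or.inr ⟨h1.1, ?_⟩
        rw [dirIm_add, dirIm_real_mul]
        have := mul_pos hη h2.2
        linarith [h1.2]
  filter_upwards [eventually_pos_of_lex this] with r hr
  rwa [sd_add_mul]

theorem sd_eq (p : Cyc) (k : ℕ) (z : ℂ) : sd (p, k) z =
    (zeta ^ k).re * (z.im - p.toC.im) - (zeta ^ k).im * (z.re - p.toC.re) := by
  simp only [sd, mul_im, conj_re, conj_im, sub_re, sub_im]
  ring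

/-! ### The pentagon as an intersection of half-planes -/

/-- The half-planes cutting out the pentagon or its mirror image in the real axis. -/
def polyC : Bool → Poly
  | false => [(⟨0, 0, 0, 0⟩, 10), (⟨3, 0, -3, 0⟩, 0), (⟨6, 0, -3, 0⟩, 4), (⟨3, 0, 0, 0⟩, 5),
      (⟨1, 0, 1, 0⟩, 7)]
  | true => [(⟨0, 0, 3, 0⟩, 8), (⟨3, 0, 3, 0⟩, 6), (⟨3, 0, 0, 0⟩, 2), (⟨2, 0, -1, 0⟩, 1),
      (⟨0, 0, 0, 0⟩, 11)]

theorem mem_closed_false (z : ℂ) : z ∈ (polyC false).closed ↔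
    0 ≤ √3 * z.re + z.im ∧ 0 ≤ z.im + √3 / 2 ∧ 0 ≤ √3 - z.im - √3 * z.re ∧
      0 ≤ 1 - √3 * z.im - z.re ∧ 0 ≤ z.re - √3 * z.im := by
  have h : √3 * √3 = (3 : ℝ) := Real.mul_self_sqrt (by norm_num)
  simp only [Poly.closed, polyC, Set.mem_ofPred_eq, List.forall_mem_cons, List.not_mem_nil,
    false_implies, implies_true, and_true, sd_eq, zeta_pow_eq_toC, Cyc.rot, Cyc.rotOne, Cyc.toC]
  push_cast
  refine and_congr ?_ (and_congr ?_ (and_congr ?_ (and_congr ?_ ?_))) <;> constructor <;> intro h1 <;>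
    nlinarith

theorem mem_closed_true (z : ℂ) : z ∈ (polyC true).closed ↔
    0 ≤ √3 * z.re - z.im ∧ 0 ≤ -z.im + √3 / 2 ∧ 0 ≤ √3 + z.im - √3 * z.re ∧
      0 ≤ 1 + √3 * z.im - z.re ∧ 0 ≤ z.re + √3 * z.im := by
  have h : √3 * √3 = (3 : ℝ) := Real.mul_self_sqrt (by norm_num)
  simp only [Poly.closed, polyC, Set.mem_ofPred_eq, List.forall_mem_cons, List.not_mem_nil,
    false_implies, implies_true, and_true, sd_eq, zeta_pow_eq_toC, Cyc.rot, Cyc.rotOne, Cyc.toC]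
  push_cast
  refine and_congr ?_ (and_congr ?_ (and_congr ?_ (and_congr ?_ ?_))) <;> constructor <;> intro h1 <;>
    nlinarith

theorem combo_three_mem {s : Set ℂ} (hs : Convex ℝ s) {x y w : ℂ} (hx : x ∈ s) (hy : y ∈ s)
    (hw : w ∈ s) {a b c : ℝ} (ha : 0 ≤ a) (hb : 0 ≤ b) (hc : 0 ≤ c) (h : a + b + c = 1) :
    (a : ℂ) * x + b * y + c * w ∈ s := by
  have := hs.sum_mem (t := Finset.univ) (w := ![a, b, c]) (z := ![x, y, w])
    (by intro i _; fin_cases i <;> simpa) (by simp [Fin.sum_univ_three, h])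
    (by intro i _; fin_cases i <;> simpa)
  simpa [Fin.sum_univ_three] using this

theorem Poly.convex_closed (P : Poly) : Convex ℝ P.closed := by
  intro x hx y hy a b ha hb hab h hh
  have : sd h (a • x + b • y) = a * sd h x + b * sd h y := by
    obtain ⟨p, k⟩ := h
    simp only [sd_eq, add_im, add_re, real_smul, im_ofReal_mul, re_ofReal_mul]
    have hb' : b = 1 - a := by linarith
    subst hb'; ring
  rw [this]
  have h1 := hx h hh
  have h2 := hy h hh
  positivity

/-- For the inclusion in the convex hull, the lines `AD` and `BD` cut the region into the triangles
`ADE`, `ABD` and `BCD`; in each of them the barycentric coordinates are written down. -/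
theorem thPentagon_eq : thPentagon = (polyC false).closed := by
  have h : √3 * √3 = (3 : ℝ) := Real.mul_self_sqrt (by norm_num)
  have hp : 0 < √3 := by positivity
  apply Set.Subset.antisymm
  · apply convexHull_min _ (Poly.convex_closed _)
    intro z hz
    rw [mem_closed_false]
    rcases hz with rfl | rfl | rfl | rfl | rfl <;>
    · simp only [vA, vB, vC, vD, vE, zero_re, zero_im, one_re, one_im]
      refine ⟨?_, ?_, ?_, ?_, ?_⟩ <;> nlinarith
  · intro z hz
    rw [mem_closed_false] at hz
    obtain ⟨h1, h2, h3, h4, h5⟩ := hz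
    have hc : Convex ℝ thPentagon := convex_convexHull ℝ _
    have mA : vA ∈ thPentagon := subset_convexHull ℝ _ (by simp)
    have mB : vB ∈ thPentagon := subset_convexHull ℝ _ (by simp)
    have mC : vC ∈ thPentagon := subset_convexHull ℝ _ (by simp)
    have mD : vD ∈ thPentagon := subset_convexHull ℝ _ (by simp)
    have mE : vE ∈ thPentagon := subset_convexHull ℝ _ (by simp)
    rcases le_total 0 z.im with hy | hy
    · have := combo_three_mem hc mA mD mE (a := 1 - z.re - √3 * z.im)
        (b := z.re - √3 * z.im) (c := 2 * √3 * z.im) (by linarith) h5 (by positivity) (by ring)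
      convert this using 1
      apply Complex.ext <;> simp [vA, vD, vE] <;> first | ring1 | linear_combination (-z.im / 3) * h
    · rcases le_total 0 (√3 - √3 * z.re + z.im) with hx | hx
      · have := combo_three_mem hc mA mD mB (a := 1 - z.re + √3 / 3 * z.im)
          (b := z.re + √3 / 3 * z.im) (c := - (2 * √3 / 3) * z.im) (by nlinarith) (by nlinarith)
          (by nlinarith) (by ring)
        convert this using 1
        apply Complex.ext <;> simp [vA, vD, vB] <;> first | ring1 | linear_combination (-z.im / 3) * h
      · have := combo_three_mem hc mB mC mD (a := 1 - z.re - √3 / 3 * z.im)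
          (b := z.re - 1 - √3 / 3 * z.im) (c := 1 + (2 * √3 / 3) * z.im) (by nlinarith)
          (by nlinarith) (by nlinarith) (by ring)
        convert this using 1
        apply Complex.ext <;> simp [vC, vD, vB] <;> first | ring1 | linear_combination (-z.im / 3) * h

/-- The pentagon, or its mirror image. -/
def model : Bool → Set ℂ
  | false => thPentagon
  | true => conj '' thPentagon

theorem model_eq (c : Bool) : model c = (polyC c).closed := by
  cases c
  · exact thPentagon_eq
  · ext z
    rw [mem_closed_true]
    have : z ∈ model true ↔ conj z ∈ thPentagon := by
      constructor
      · rintro ⟨w, hw, rfl⟩; simpa using hw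
      · intro h; exact ⟨_, h, by simp⟩
    rw [this, thPentagon_eq, mem_closed_false]
    simp only [conj_re, conj_im, mul_neg, sub_neg_eq_add]
    simp only [← sub_eq_add_neg]

/-- The image of a model pentagon under `z ↦ a z + b`. -/
def tileSet (a b : ℂ) (c : Bool) : Set ℂ := (fun z => a * z + b) '' model c

theorem mem_tileSet {a b : ℂ} (ha : ‖a‖ = 1) {c : Bool} {z : ℂ} :
    z ∈ tileSet a b c ↔ conj a * (z - b) ∈ (polyC c).closed := by
  have h := conj_mul_self_of_norm ha
  rw [tileSet, model_eq]
  constructor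
  · rintro ⟨w, hw, rfl⟩
    rw [show conj a * ((fun z => a * z + b) w - b) = (conj a * a) * w by simp; ring, h, one_mul]
    exact hw
  · intro hz
    refine ⟨_, hz, ?_⟩
    linear_combination (z - b) * h

theorem Poly.isOpen_inner (P : Poly) : IsOpen P.inner := by
  have : P.inner = ⋂ h ∈ {h | h ∈ P}, {z | 0 < sd h z} := by
    ext z; simp [Poly.inner]
  rw [this]
  apply Set.Finite.isOpen_biInter (List.finite_toSet P)
  intro h _
  apply isOpen_lt continuous_const
  unfold sd
  fun_prop

theorem Poly.inner_subset_closed (P : Poly) : P.inner ⊆ P.closed := fun _ hz h hh => (hz h hh).le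

theorem mem_interior_tileSet {a b : ℂ} (ha : ‖a‖ = 1) {c : Bool} {z : ℂ}
    (hz : conj a * (z - b) ∈ (polyC c).inner) : z ∈ interior (tileSet a b c) := by
  refine mem_interior.mpr ⟨{z | conj a * (z - b) ∈ (polyC c).inner}, ?_, ?_, hz⟩
  · intro w hw
    exact (mem_tileSet ha).mpr (Poly.inner_subset_closed _ hw)
  · exact (Poly.isOpen_inner _).preimage (by fun_prop)

theorem sd_add_zeta (h : HalfPlane) (q : Cyc) (d : ℕ) (t : ℝ) :
    sd h (q.toC + t * zeta ^ d) = sd h q.toC + t * dirIm h.2 (zeta ^ d) := sd_add_mul _ _ _ _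

/-- The vertices of the model pentagons: along an edge no other edge line is met except at the
ends. -/
theorem polyC_edge (c : Bool) : ∀ h ∈ polyC c,
    (∀ h' ∈ polyC c, h' ≠ h → 0 ≤ sd h' h.1.toC ∧
      ¬ (sd h' h.1.toC = 0 ∧ dirIm h'.2 (zeta ^ h.2) = 0)) ∧
    ∃ h' ∈ polyC c, sd h' h.1.toC = 0 ∧ 0 < dirIm h'.2 (zeta ^ h.2) := by
  have key : ∀ h ∈ polyC c,
      (∀ h' ∈ polyC c, h' ≠ h → (posRt (sdPair h' h.1) = true ∨ zeroRt (sdPair h' h.1) = true) ∧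
        ¬ (zeroRt (sdPair h' h.1) = true ∧ (ang h'.2 h.2 = 0 ∨ ang h'.2 h.2 = 6))) ∧
      ∃ h' ∈ polyC c, zeroRt (sdPair h' h.1) = true ∧ (0 < ang h'.2 h.2 ∧ ang h'.2 h.2 < 6) := by
    cases c <;> decide
  intro h hh
  obtain ⟨h1, h', hh', h2⟩ := key h hh
  rw [sd_zero_iff, ← dirIm_zeta_pow_pos_iff] at h2
  refine ⟨fun h'' hh'' hne => ?_, h', hh', h2⟩
  have := h1 h'' hh'' hne
  rw [sd_pos_iff, sd_zero_iff, ← dirIm_zeta_pow_zero_iff] at this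
  refine ⟨?_, this.2⟩
  rcases this.1 with h3 | h3
  · exact h3.le
  · exact h3.ge

theorem zeta_pow_mul_bis (d j : ℕ) : zeta ^ d * bis j = bis (d + j) := by
  simp only [bis]; ring

theorem eq_real_of_im_zero {y : ℂ} (h : y.im = 0) : y = (y.re : ℂ) := by
  apply Complex.ext <;> simp [h]

theorem eq_add_of_conj_mul {d : ℕ} {p q : ℂ} {t : ℂ} (h : conj (zeta ^ d) * (p - q) = t) :
    p = q + t * zeta ^ d := by
  have := conj_mul_self_of_norm (norm_zeta_pow d)
  rw [← h]; linear_combination (q - p) * this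

/-! ### Tiles forced to have an edge along a ray -/

/-- A tile reaching into the sector on the left of the ray from `p` in direction `ζ ^ k`, whose
interior avoids the sector on its right, has an edge along this ray: it starts at `p`, or `p` is in
the interior of the edge. -/
theorem edge_along_ray {a b : ℂ} {c : Bool} (ha : ‖a‖ = 1) (p : ℂ) (k : ℕ)
    (h1 : ∃ᶠ η : ℝ in 𝓝[>] 0, ∃ᶠ r : ℝ in 𝓝[>] 0,
      p + r * (zeta ^ k + η * bis k) ∈ tileSet a b c)
    (h2 : ∀ η : ℝ, 0 < η → ∀ᶠ r : ℝ in 𝓝[>] 0,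
      p + r * (zeta ^ k + η * bis (k + 11)) ∉ interior (tileSet a b c)) :
    ∃ h ∈ polyC c, a * zeta ^ h.2 = zeta ^ k ∧ (p = a * h.1.toC + b ∨
      ∀ j < 6, ∀ᶠ r : ℝ in 𝓝[>] 0, p + r * bis (k + j) ∈ interior (tileSet a b c)) := by
  have haa := conj_mul_self_of_norm ha
  obtain ⟨p', hp'⟩ : ∃ p', p' = conj a * (p - b) := ⟨_, rfl⟩
  obtain ⟨u, hu⟩ : ∃ u, u = conj a * zeta ^ k := ⟨_, rfl⟩
  have pull : ∀ (r η : ℝ) (j : ℕ), conj a * (p + r * (zeta ^ k + η * bis (k + j)) - b)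
      = p' + r * (u + η * (u * bis j)) := by
    intro r η j
    rw [hp', hu, ← zeta_pow_mul_bis]; ring
  have pull' : ∀ (r : ℝ) (j : ℕ), conj a * (p + r * bis (k + j) - b) = p' + r * (u * bis j) := by
    intro r j
    rw [hp', hu, ← zeta_pow_mul_bis]; ring
  have h1' : ∃ᶠ η : ℝ in 𝓝[>] 0, ∃ᶠ r : ℝ in 𝓝[>] 0, ∀ h ∈ polyC c,
      0 ≤ sd h p' + r * (dirIm h.2 u + η * dirIm h.2 (u * bis 0)) := by
    refine h1.mono fun η hη => hη.mono fun r hr h hh => ?_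
    have pull0 := pull r η 0
    rw [add_zero] at pull0
    rw [mem_tileSet ha, pull0] at hr
    have := hr h hh
    rwa [sd_add_mul, dirIm_add, dirIm_real_mul] at this
  have hpos : ∀ᶠ r : ℝ in 𝓝[>] 0, (0 : ℝ) < r := self_mem_nhdsWithin
  have A1 : ∀ h ∈ polyC c, 0 ≤ sd h p' := by
    intro h hh
    by_contra hc
    obtain ⟨η, hη⟩ := h1'.exists
    obtain ⟨r, hr, hr'⟩ := (hη.and_eventually (eventually_neg_of_neg
      (d := dirIm h.2 u + η * dirIm h.2 (u * bis 0)) (not_le.mp hc))).exists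
    linarith [hr h hh]
  have A2 : ∀ h ∈ polyC c, sd h p' = 0 → 0 ≤ dirIm h.2 u := by
    intro h hh h0
    by_contra hc
    obtain ⟨η, hη, hη'⟩ := (h1'.and_eventually (eventually_neg_of_neg
      (d := dirIm h.2 (u * bis 0)) (not_le.mp hc))).exists
    obtain ⟨r, hr, hr'⟩ := (hη.and_eventually hpos).exists
    have := hr h hh
    rw [h0, zero_add] at this
    linarith [mul_neg_of_pos_of_neg hr' hη']
  -- If no edge line through `p'` is parallel to `u`, then `u` lies in the open tangent cone at
  -- `p'`. A slight tilt to the right then stays in the interior of the tile, contrary to `h2`.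
  obtain ⟨h, hh, h0, hd0⟩ : ∃ h ∈ polyC c, sd h p' = 0 ∧ dirIm h.2 u = 0 := by
    by_contra hc
    push Not at hc
    have : ∀ᶠ η : ℝ in 𝓝[>] 0, ∀ h ∈ polyC c,
        0 < sd h p' ∨ (sd h p' = 0 ∧ 0 < dirIm h.2 u + η * dirIm h.2 (u * bis 11)) := by
      apply eventually_all_list
      intro h hh
      rcases (A1 h hh).lt_or_eq with h3 | h3
      · exact Eventually.of_forall fun _ => Or.inl h3
      · have h4 := lt_of_le_of_ne (A2 h hh h3.symm) (hc h hh h3.symm).symm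
        filter_upwards [eventually_pos_of_lex (d := dirIm h.2 (u * bis 11)) (Or.inl h4)] with η hη
        exact Or.inr ⟨h3.symm, hη⟩
    obtain ⟨η, hη, hη'⟩ := (this.and hpos).exists
    have h5 : ∀ᶠ r : ℝ in 𝓝[>] 0, ∀ h ∈ polyC c,
        0 < sd h p' + r * (dirIm h.2 u + η * dirIm h.2 (u * bis 11)) :=
      eventually_all_list _ fun h hh => eventually_pos_of_lex (hη h hh)
    obtain ⟨r, hr, hr'⟩ := (h5.and (h2 η hη')).exists
    apply hr'
    apply mem_interior_tileSet ha
    rw [pull]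
    intro h hh
    rw [sd_add_mul, dirIm_add, dirIm_real_mul]
    exact hr h hh
  have hu1 : ‖u‖ = 1 := by rw [hu, norm_mul, norm_zeta_pow, RCLike.norm_conj, ha, one_mul]
  have hux := eq_real_of_im_zero hd0
  have hnx : ‖conj (zeta ^ h.2) * u‖ = 1 := by
    rw [norm_mul, RCLike.norm_conj, norm_zeta_pow, hu1, one_mul]
  obtain ⟨x, hx⟩ : ∃ x : ℝ, conj (zeta ^ h.2) * u = x := ⟨_, hux⟩
  -- A unit vector on the edge line is plus or minus its direction; the minus sign would put the
  -- left sector outside the half-plane.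
  have hx1 : x = 1 := by
    obtain ⟨η, hη, hη'⟩ := (h1'.and_eventually hpos).exists
    obtain ⟨r, hr, hr'⟩ := (hη.and_eventually hpos).exists
    have h6 := hr h hh
    rw [h0, hd0, zero_add, zero_add] at h6
    have h7 : dirIm h.2 (u * bis 0) = x * (1 / 2) := by
      rw [dirIm, ← mul_assoc, hx, im_ofReal_mul]
      simp [bis, zeta]
    rw [h7] at h6
    rw [hx] at hnx
    have h8 : |x| = 1 := by simpa using hnx
    rcases (abs_eq zero_le_one).mp h8 with h9 | h9
    · exact h9
    · subst h9
      have := mul_pos hr' hη'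
      nlinarith
  have hud : u = zeta ^ h.2 := by
    have := eq_add_of_conj_mul (d := h.2) (p := u) (q := 0) (t := 1) (by rw [sub_zero, hx, hx1]; simp)
    simpa using this
  have hab : a * zeta ^ h.2 = zeta ^ k := by
    rw [← hud, hu]; linear_combination (zeta ^ k) * haa
  refine ⟨h, hh, hab, ?_⟩
  obtain ⟨t, ht⟩ : ∃ t : ℝ, conj (zeta ^ h.2) * (p' - h.1.toC) = t := ⟨_, eq_real_of_im_zero h0⟩
  have hpt := eq_add_of_conj_mul ht
  obtain ⟨e1, h', hh', e2, e3⟩ := polyC_edge c h hh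
  have ht0 : 0 ≤ t := by
    have := A1 h' hh'
    rw [hpt, sd_add_zeta, e2, zero_add] at this
    exact nonneg_of_mul_nonneg_left this e3
  rcases ht0.eq_or_lt with ht1 | ht1
  · left
    rw [← ht1] at hpt
    simp only [ofReal_zero, zero_mul, add_zero] at hpt
    rw [← hpt, hp']; linear_combination (b - p) * haa
  · right
    intro j hj
    have : ∀ᶠ r : ℝ in 𝓝[>] 0, ∀ g ∈ polyC c, 0 < sd g p' + r * dirIm g.2 (u * bis j) := by
      apply eventually_all_list
      intro g hg
      apply eventually_pos_of_lex
      by_cases hgh : g = h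
      · subst hgh
        refine Or.inr ⟨h0, ?_⟩
        rw [hud, zeta_pow_mul_bis, dirIm_bis_pos_iff, ang]
        omega
      · left
        obtain ⟨e4, e5⟩ := e1 g hg hgh
        apply lt_of_le_of_ne (A1 g hg)
        -- A second edge line through `p'` has nonnegative slack at the start of the edge and, by
        -- `A2`, a nonnegative rate along it. The sum vanishes, so both terms do, against `e5`. This
        -- also excludes the far end of the edge.
        intro h0g
        have hb := A2 g hg h0g.symm
        rw [hud] at hb
        have h0g' := h0g
        rw [hpt, sd_add_zeta] at h0g'
        have := mul_nonneg ht1.le hb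
        apply e5
        refine ⟨by linarith, ?_⟩
        have h10 : t * dirIm g.2 (zeta ^ h.2) = 0 := by linarith
        exact (mul_eq_zero.mp h10).resolve_left ht1.ne'
    filter_upwards [this] with r hr
    apply mem_interior_tileSet ha
    rw [pull']
    intro g hg
    rw [sd_add_mul]
    exact hr g hg

/-! ### Search for forced tiles, and its soundness -/

/-- A tiling of `X` by finitely many TH-pentagons. -/
structure IsTiling {n : ℕ} (T : Fin n → Set ℂ) (X : Set ℂ) : Prop where
  tile : ∀ i, ∃ (a b : ℂ) (c : Bool), ‖a‖ = 1 ∧ T i = tileSet a b c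
  disj : Pairwise fun i j => Disjoint (interior (T i)) (interior (T j))
  cover : ⋃ i, T i = X

/-- A tile in lattice position: the image of a model pentagon under `z ↦ ζ ^ k z + p`. -/
structure Placement where
  pos : Cyc
  dir : ℕ
  flip : Bool
deriving DecidableEq

namespace Placement

noncomputable def set (N : Placement) : Set ℂ := tileSet (zeta ^ N.dir) N.pos.toC N.flip

def poly (N : Placement) : Poly :=
  (polyC N.flip).map fun h => (N.pos.add (Cyc.rot N.dir h.1), (h.2 + N.dir) % 12)

/-- The vertices of a tile. -/
def verts (N : Placement) : List Cyc := N.poly.map Prod.fst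

theorem sd_move (N : Placement) (h : HalfPlane) (z : ℂ) :
    sd (N.pos.add (Cyc.rot N.dir h.1), (h.2 + N.dir) % 12) z
      = sd h (conj (zeta ^ N.dir) * (z - N.pos.toC)) := by
  have := conj_mul_self_of_norm (norm_zeta_pow N.dir)
  simp only [sd, Cyc.toC_add, Cyc.toC_rot, zeta_pow_mod, pow_add, map_mul]
  congr 1
  linear_combination (-conj (zeta ^ h.2) * h.1.toC) * this

theorem mem_closed_poly (N : Placement) (z : ℂ) :
    z ∈ N.poly.closed ↔ conj (zeta ^ N.dir) * (z - N.pos.toC) ∈ (polyC N.flip).closed := by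
  simp only [Poly.closed, poly, List.mem_map, Set.mem_ofPred_eq, forall_exists_index, and_imp,
    forall_apply_eq_imp_iff₂, sd_move]

theorem mem_inner_poly (N : Placement) (z : ℂ) :
    z ∈ N.poly.inner ↔ conj (zeta ^ N.dir) * (z - N.pos.toC) ∈ (polyC N.flip).inner := by
  simp only [Poly.inner, poly, List.mem_map, Set.mem_ofPred_eq, forall_exists_index, and_imp,
    forall_apply_eq_imp_iff₂, sd_move]

theorem set_eq (N : Placement) : N.set = N.poly.closed := by
  ext z
  rw [mem_closed_poly, set, mem_tileSet (norm_zeta_pow _)]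

theorem inner_subset (N : Placement) : N.poly.inner ⊆ interior N.set := by
  intro z hz
  rw [mem_inner_poly] at hz
  exact mem_interior_tileSet (norm_zeta_pow _) hz

end Placement

/-- The ten tiles with an edge starting at `p` in direction `ζ ^ k`, on the left of it. -/
def options (p : Cyc) (k : ℕ) : List Placement :=
  [false, true].flatMap fun c => (polyC c).map fun h =>
    ⟨p.sub (Cyc.rot ((k + 11 * h.2) % 12) h.1), (k + 11 * h.2) % 12, c⟩

/-- The obstacle `P` fills the sector on the right of the ray from `p` in direction `ζ ^ k`,
and this ray is on its boundary. -/
def isWall (P : Poly) (p : Cyc) (k : ℕ) : Bool :=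
  closedDir P p k && occ P p (k + 11)

def closedMem (P : Poly) (p : Cyc) : Bool :=
  P.all fun h => posRt (sdPair h p) || zeroRt (sdPair h p)

/-- Two regions overlap near their common point `q`. -/
def clashAt (P Q : Poly) (q : Cyc) : Bool :=
  closedMem P q && closedMem Q q && (List.range 12).any fun m => occ P q m && occ Q q m

/-- Two tiles overlap near a common point which is a vertex of one of them. -/
def overlapTiles (N K : Placement) : Bool :=
  N.verts.any (fun q => clashAt K.poly N.poly q) || K.verts.any fun q => clashAt N.poly K.poly q

/-- What is known about the region: open convex sets in the complement, a test for sectors inside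
the region, and target tiles. -/
structure Problem where
  outs : List Poly
  inside : Cyc → ℕ → Bool
  goals : List Placement

namespace Problem

variable (pr : Problem)

def obstacles (known : List Placement) : List Poly := known.map Placement.poly ++ pr.outs

/-- The ray from `p` in direction `ζ ^ k` can be used to find a new tile. -/
def validProbe (known : List Placement) (p : Cyc) (k : ℕ) : Bool :=
  pr.inside p k && (pr.obstacles known).any (fun P => isWall P p k) &&
    known.all (fun N => !(occ N.poly p k)) &&
    (pr.obstacles known).any (fun P => (List.range 6).any fun i => occ P p (k + i))

/-- Goals are dropped because a branch that contains one is finished. The overlap tests look at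
vertices only and may miss an overlap; a superfluous candidate costs a branch but does no harm. -/
def excluded (known : List Placement) (p : Cyc) (N : Placement) : Bool :=
  pr.goals.contains N || (pr.obstacles known).any (fun P => clashAt P N.poly p) ||
    known.any (overlapTiles N) || pr.outs.any (fun P => N.verts.any fun q => clashAt P N.poly q)

def survivors (known : List Placement) (p : Cyc) (k : ℕ) : List Placement :=
  (options p k).filter fun N => !(pr.excluded known p N)

end Problem

/-- A list of search trees; each tree is a probe and the list of trees for the surviving tiles. -/
inductive Forest
  | nil : Forest
  | tree (p : Cyc) (k : ℕ) (children : Forest) (others : Forest) : Forest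

/-- The list holds the sibling cases still to be refuted, in the order in which `survivors` produces
them; `nil` closes a level only if no case is left. -/
def Problem.run (pr : Problem) : Forest → List (List Placement) → Bool
  | .nil, l => l.isEmpty
  | .tree p k ch oth, l => match l with
    | [] => false
    | known :: l' => pr.validProbe known p k &&
        pr.run ch ((pr.survivors known p k).map fun N => N :: known) && pr.run oth l'

/-- The data of a problem are correct for the region `X`. -/
structure Problem.Sound (pr : Problem) (X : Set ℂ) : Prop where
  outs : ∀ P ∈ pr.outs, Disjoint P.inner X
  inside : ∀ p k, pr.inside p k = true → ∀ η : ℝ, 0 < η → η < 1 → ∀ᶠ r : ℝ in 𝓝[>] 0,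
    p.toC + r * (zeta ^ k + η * bis k) ∈ X

def Known {n : ℕ} (T : Fin n → Set ℂ) (N : Placement) : Prop := ∃ i, T i = N.set

section

variable {n : ℕ} {T : Fin n → Set ℂ} {X : Set ℂ} {pr : Problem}

theorem IsTiling.eq_of_mem (hT : IsTiling T X) {i j : Fin n} {z : ℂ} (hi : z ∈ interior (T i))
    (hj : z ∈ interior (T j)) : i = j := by
  by_contra h
  exact Set.disjoint_left.mp (hT.disj h) hi hj

theorem IsTiling.subset (hT : IsTiling T X) (i : Fin n) : T i ⊆ X := by
  rw [← hT.cover]; exact Set.subset_iUnion T i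

/-- Pigeonhole over the finitely many tiles, used twice: if each one eventually misses the sector,
then so does their union. -/
theorem IsTiling.exists_tile_in_sector (hT : IsTiling T X) {p : ℂ} {v w : ℂ}
    (h : ∀ η : ℝ, 0 < η → η < 1 → ∀ᶠ r : ℝ in 𝓝[>] 0, p + r * (v + η * w) ∈ X) :
    ∃ i, ∃ᶠ η : ℝ in 𝓝[>] 0, ∃ᶠ r : ℝ in 𝓝[>] 0, p + r * (v + η * w) ∈ T i := by
  by_contra hc
  push Not at hc
  have h1 : ∀ᶠ η : ℝ in 𝓝[>] 0, ∀ i, ∀ᶠ r : ℝ in 𝓝[>] 0, p + r * (v + η * w) ∉ T i := by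
    rw [eventually_all]
    intro i
    simpa [not_frequently] using hc i
  have h2 : ∀ᶠ η : ℝ in 𝓝[>] 0, 0 < η ∧ η < 1 := Ioo_mem_nhdsGT one_pos
  obtain ⟨η, hη, h3, h4⟩ := (h1.and h2).exists
  rw [← eventually_all] at hη
  obtain ⟨r, hr, hr'⟩ := (hη.and (h η h3 h4)).exists
  rw [← hT.cover, Set.mem_iUnion] at hr'
  obtain ⟨i, hi⟩ := hr'
  exact hr i hi

theorem clashAt_sound {P Q : Poly} {q : Cyc} (h : clashAt P Q q = true) :
    ∃ z, z ∈ P.inner ∧ z ∈ Q.inner := by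
  simp only [clashAt, List.any_eq_true, Bool.and_eq_true] at h
  obtain ⟨-, m, -, h1, h2⟩ := h
  obtain ⟨r, hr⟩ := ((occ_sound h1).and (occ_sound h2)).exists
  exact ⟨_, hr⟩

theorem overlapTiles_sound {N K : Placement} (h : overlapTiles N K = true) :
    ∃ z, z ∈ N.poly.inner ∧ z ∈ K.poly.inner := by
  simp only [overlapTiles, List.any_eq_true, Bool.or_eq_true] at h
  rcases h with ⟨q, -, h⟩ | ⟨q, -, h⟩
  · obtain ⟨z, h1, h2⟩ := clashAt_sound h
    exact ⟨z, h2, h1⟩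
  · exact clashAt_sound h

/-- Start and direction of one edge determine the rotation and the translation. Here an arbitrary
congruent copy becomes a lattice placement. -/
theorem options_mem {a b : ℂ} {c : Bool} {p : Cyc} {k : ℕ} {h : HalfPlane}
    (hh : h ∈ polyC c) (h1 : a * zeta ^ h.2 = zeta ^ k) (h2 : p.toC = a * h.1.toC + b) :
    ∃ N ∈ options p k, tileSet a b c = N.set := by
  refine ⟨⟨p.sub (Cyc.rot ((k + 11 * h.2) % 12) h.1), (k + 11 * h.2) % 12, c⟩, ?_, ?_⟩
  · simp only [options, List.mem_flatMap, List.mem_map]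
    exact ⟨c, by cases c <;> simp, h, hh, rfl⟩
  · have e : a = zeta ^ ((k + 11 * h.2) % 12) := by
      have := conj_mul_self_of_norm (norm_zeta_pow h.2)
      rw [zeta_pow_mod, pow_add, ← h1, ← conj_zeta_pow]
      linear_combination (-a) * this
    simp only [Placement.set]
    rw [← e, Cyc.toC_sub, Cyc.toC_rot, ← e, h2]
    congr 1; ring

/-- Each candidate fills the sector just left of its ray. A valid probe requires the known tiles to
miss this sector, so the tile found is new. -/
theorem occ_options {p : Cyc} {k : ℕ} {N : Placement} (h : N ∈ options p k) :
    ∀ᶠ r : ℝ in 𝓝[>] 0, p.toC + r * bis k ∈ N.poly.inner := by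
  simp only [options, List.mem_flatMap, List.mem_map] at h
  obtain ⟨c, -, h, hh, rfl⟩ := h
  have key : ∀ h ∈ polyC c, occ (polyC c) h.1 h.2 = true := by cases c <;> decide
  filter_upwards [occ_sound (key h hh)] with r hr
  rw [Placement.mem_inner_poly]
  convert hr using 1
  simp only [Cyc.toC_sub, Cyc.toC_rot]
  have e1 := conj_mul_self_of_norm (norm_zeta_pow ((k + 11 * h.2) % 12))
  have e2 : zeta ^ ((k + 11 * h.2) % 12) * bis h.2 = bis k := by
    have := conj_mul_self_of_norm (norm_zeta_pow h.2)
    rw [zeta_pow_mod, pow_add, ← conj_zeta_pow, ← add_zero h.2, ← zeta_pow_mul_bis, add_zero,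
      ← add_zero k, ← zeta_pow_mul_bis, add_zero]
    linear_combination (zeta ^ k * bis 0) * this
  linear_combination (h.1.toC + r * bis h.2) * e1 - conj (zeta ^ ((k + 11 * h.2) % 12)) * r * e2

/-- Some tile reaches into the left sector. The wall forces one of its edges onto the ray, and the
obstacle `B` on the left forces this edge to start at `p`. The tile is thus one of the ten options,
and the excluded ones that are not goals would overlap a known tile or leave the region. -/
theorem Problem.probe_sound (hs : pr.Sound X) (hT : IsTiling T X) {known : List Placement}
    (hk : ∀ N ∈ known, Known T N) {p : Cyc} {k : ℕ} (hv : pr.validProbe known p k = true) :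
    (∃ G ∈ pr.goals, Known T G) ∨ ∃ N ∈ pr.survivors known p k, Known T N := by
  simp only [Problem.validProbe, Bool.and_eq_true, List.any_eq_true, List.all_eq_true,
    Bool.not_eq_true'] at hv
  obtain ⟨⟨⟨hin, W, hW, hwall⟩, hno⟩, B, hB, i₀, hi₀, hocc⟩ := hv
  obtain ⟨i, hi⟩ := hT.exists_tile_in_sector (hs.inside p k hin)
  obtain ⟨a, b, c, ha, hab⟩ := hT.tile i
  have hne : ∀ N ∈ known, T i ≠ N.set → ∀ z ∈ N.poly.inner, z ∉ interior (T i) := by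
    rintro N hN hd z hz hz'
    obtain ⟨j, hj⟩ := hk N hN
    have := N.inner_subset hz
    rw [← hj] at this
    exact hd (by rw [hT.eq_of_mem hz' this, hj])
  -- A tile whose interior contains the points near `p` along the bisector cannot be a known one,
  -- since those miss this sector.
  have hself : ∀ N ∈ known, (∀ᶠ r : ℝ in 𝓝[>] 0, p.toC + r * bis k ∈ interior (T i)) →
      T i ≠ N.set := by
    intro N hN h1 h2
    obtain ⟨r, hr, hr'⟩ := (h1.and (not_occ_sound (hno N hN))).exists
    rw [← Placement.set_eq, ← h2] at hr'
    exact hr' (interior_subset hr)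
  have hobs : ∀ P ∈ pr.obstacles known, (∀ᶠ r : ℝ in 𝓝[>] 0, p.toC + r * bis k ∈ interior (T i)) →
      ∀ z ∈ P.inner, z ∉ interior (T i) := by
    intro P hP h1 z hz hz'
    rcases List.mem_append.mp hP with h | h
    · obtain ⟨N, hN, rfl⟩ := List.mem_map.mp h
      exact hne N hN (hself N hN h1) z hz hz'
    · exact Set.disjoint_left.mp (hs.outs P h) hz (hT.subset i (interior_subset hz'))
  -- Here `hself` is not yet available, so the case that the tile found is the wall itself is
  -- treated separately: reaching into the left sector while having the ray in its closed cone, it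
  -- would occupy that sector.
  have hwall' : ∀ z ∈ W.inner, z ∉ interior (T i) := by
    intro z hz hz'
    rcases List.mem_append.mp hW with h | h
    · obtain ⟨N, hN, rfl⟩ := List.mem_map.mp h
      refine hne N hN ?_ z hz hz'
      intro heq
      have hcl := hno N hN
      rw [heq, Placement.set_eq] at hi
      have hocc' : occ N.poly p k = true := by
        simp only [isWall, Bool.and_eq_true, closedDir, List.all_eq_true, Bool.or_eq_true,
          decide_eq_true_eq] at hwall
        simp only [occ, List.all_eq_true, Bool.or_eq_true, Bool.and_eq_true, decide_eq_true_eq]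
        intro g hg
        rcases hwall.1 g hg with h1 | ⟨h1, h2⟩
        · exact Or.inl h1
        · refine Or.inr ⟨h1, ?_⟩
          rcases h2.lt_or_eq with h3 | h3
          · exact h3
          · exfalso
            rw [sd_zero_iff] at h1
            obtain ⟨η, hη, hη'⟩ := (hi.and_eventually self_mem_nhdsWithin).exists
            obtain ⟨r, hr, hr'⟩ := (hη.and_eventually self_mem_nhdsWithin).exists
            have h4 := hr g hg
            have h5 : dirIm g.2 (zeta ^ k) = 0 := (dirIm_zeta_pow_zero_iff _ _).mpr (Or.inr h3)
            have h6 : ¬ 0 < dirIm g.2 (bis k) := by rw [dirIm_bis_pos_iff]; omega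
            have h7 := lt_of_le_of_ne (not_lt.mp h6) (dirIm_bis_ne_zero _ _)
            rw [sd_add_mul, dirIm_add, dirIm_real_mul, h1, h5, zero_add, zero_add] at h4
            have h8 : η * dirIm g.2 (bis k) < 0 := mul_neg_of_pos_of_neg hη' h7
            linarith [mul_neg_of_pos_of_neg (show (0:ℝ) < r from hr') h8]
      rw [hcl] at hocc'
      exact Bool.false_ne_true hocc'
    · exact Set.disjoint_left.mp (hs.outs W h) hz (hT.subset i (interior_subset hz'))
  have hw2 : ∀ η : ℝ, 0 < η → ∀ᶠ r : ℝ in 𝓝[>] 0,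
      p.toC + r * (zeta ^ k + η * bis (k + 11)) ∉ interior (tileSet a b c) := by
    intro η hη
    simp only [isWall, Bool.and_eq_true] at hwall
    filter_upwards [closedDir_sound hwall.1 hwall.2 hη] with r hr
    rw [← hab]
    exact hwall' _ hr
  obtain ⟨h, hh, he, hcase⟩ := edge_along_ray ha p.toC k (by rw [← hab]; exact hi) hw2
  rcases hcase with hcase | hcase
  · obtain ⟨N, hN, hNs⟩ := options_mem hh he hcase
    have hTN : T i = N.set := hab.trans hNs
    have hdir : ∀ᶠ r : ℝ in 𝓝[>] 0, p.toC + r * bis k ∈ interior (T i) := by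
      filter_upwards [occ_options hN] with r hr
      rw [hTN]; exact N.inner_subset hr
    by_cases hg : N ∈ pr.goals
    · exact Or.inl ⟨N, hg, i, hTN⟩
    · refine Or.inr ⟨N, ?_, i, hTN⟩
      rw [Problem.survivors, List.mem_filter]
      refine ⟨hN, ?_⟩
      rw [Bool.not_eq_true']
      by_contra hex
      rw [Bool.not_eq_false, Problem.excluded, Bool.or_eq_true, Bool.or_eq_true, Bool.or_eq_true] at hex
      rcases hex with ((hex | hex) | hex) | hex
      · exact hg (by simpa using hex)
      · obtain ⟨P, hP, hov⟩ := List.any_eq_true.mp hex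
        obtain ⟨z, hz1, hz2⟩ := clashAt_sound hov
        refine hobs P hP hdir z hz1 ?_
        rw [hTN]; exact N.inner_subset hz2
      · obtain ⟨K, hK, hov⟩ := List.any_eq_true.mp hex
        obtain ⟨z, hz1, hz2⟩ := overlapTiles_sound hov
        refine hobs _ (List.mem_append_left _ (List.mem_map_of_mem hK)) hdir z hz2 ?_
        rw [hTN]; exact N.inner_subset hz1
      · obtain ⟨P, hP, hov⟩ := List.any_eq_true.mp hex
        obtain ⟨q, -, hq⟩ := List.any_eq_true.mp hov
        obtain ⟨z, hz1, hz2⟩ := clashAt_sound hq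
        refine hobs _ (List.mem_append_right _ hP) hdir z hz1 ?_
        rw [hTN]; exact N.inner_subset hz2
  -- If `p` were interior to the edge, the tile would fill all six sectors on the left, including
  -- the one occupied by `B`.
  · exfalso
    rw [← hab] at hcase
    have h0 := hcase 0 (by norm_num)
    rw [add_zero] at h0
    obtain ⟨r, hr, hr'⟩ := ((hcase i₀ (List.mem_range.mp hi₀)).and (occ_sound hocc)).exists
    exact hobs B hB h0 _ hr' hr

theorem Problem.run_sound (hs : pr.Sound X) (hT : IsTiling T X) (F : Forest) :
    ∀ l, pr.run F l = true → ∀ known ∈ l, (∀ N ∈ known, Known T N) →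
      ∃ G ∈ pr.goals, Known T G := by
  induction F with
  | nil =>
    intro l h known hm
    simp only [Problem.run, List.isEmpty_iff] at h
    subst h; simp at hm
  | tree p k ch oth ih1 ih2 =>
    intro l h known hm hk
    cases l with
    | nil => simp at hm
    | cons kn l =>
      simp only [Problem.run, Bool.and_eq_true] at h
      rcases List.mem_cons.mp hm with rfl | hm
      · rcases Problem.probe_sound hs hT hk h.1.1 with hG | ⟨N, hN, hN'⟩
        · exact hG
        · apply ih1 _ h.1.2 (N :: known) (List.mem_map_of_mem hN)
          intro K hK
          rcases List.mem_cons.mp hK with rfl | hK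
          · exact hN'
          · exact hk K hK
      · exact ih2 _ h.2 known hm hk

end

/-! ### Certified searches near the boundary of a flower -/

/-! Tiles lying above the real axis, with one edge on the segment from `x` to `x + 1`; the name
gives the end points of this edge from left to right. -/

def tileBC (x : ℤ) : Placement := ⟨⟨3 * x - 3, 0, 3, 0⟩, 0, false⟩
def tileBA (x : ℤ) : Placement := ⟨⟨3 * x + 3, 0, 0, 0⟩, 4, true⟩
def tileAB (x : ℤ) : Placement := ⟨⟨3 * x, 0, 0, 0⟩, 2, false⟩
def tileCB (x : ℤ) : Placement := ⟨⟨3 * x + 3, 0, 3, 0⟩, 6, true⟩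
def tileCD (x : ℤ) : Placement := ⟨⟨3 * x + 3, 0, 3, 0⟩, 8, false⟩

/-- The tile with its edge `CD` at the far end of the left side of a flower of side length 4. -/
def tileFarLeft : Placement := ⟨⟨-12, 0, 15, 0⟩, 8, true⟩

/-- The point `3 x ζ ^ k` in lattice coordinates. -/
def pt (x : ℤ) (k : ℕ) : Cyc := Cyc.rot k ⟨3 * x, 0, 0, 0⟩

/-- The lower half-plane. -/
def belowPoly : Poly := [(⟨0, 0, 0, 0⟩, 6)]

/-- The points on the left of the left side, below its upper end. -/
def leftPoly : Poly := [(⟨0, 0, 0, 0⟩, 4), (pt 4 4, 6)]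

/-- The regular hexagon of side length `m` on the segment from `0` to `m`. -/
def hexPoly (m : ℤ) : Poly :=
  [(⟨0, 0, 0, 0⟩, 0), (pt m 0, 2), ((pt m 0).add (pt m 2), 4),
    (((pt m 0).add (pt m 2)).add (pt m 4), 6), ((pt m 2).add (pt m 4), 8), (pt m 4, 10)]

/-- The points above the segment from `-2` to `1` in a flower of side length at least 4. -/
def stripPoly : Poly := [(⟨0, 0, 0, 0⟩, 0), (pt 1 0, 2), (pt 4 2, 6), (pt (-2) 0, 10)]

def insidePoly (P : Poly) (p : Cyc) (k : ℕ) : Bool := closedDir P p k && occ P p k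

def node (a b c d : ℤ) (k : ℕ) (children others : Forest) : Forest :=
  .tree ⟨a, b, c, d⟩ k children others

/-- The tile at the left corner. -/
def cornerProblem : Problem where
  outs := [belowPoly, leftPoly]
  inside := insidePoly (hexPoly 4)
  goals := [tileBC 0, tileCD 3]

/-- At 0 the wall is the lower half-plane and the stopping obstacle is the outside beyond the left
side. The goal `tileCD 3` has its vertex `D` at 4, where the hexagon of side 4 ends and the search
cannot continue; it is refuted separately by `no_vertex_D`. -/
theorem cornerProblem_run : ∃ F, cornerProblem.run F [[]] = true :=
  ⟨node 0 0 0 0 0 (node 0 0 0 0 3 .nil (node 3 0 0 0 0 .nil (node 0 (-1) 0 2 3 .nil (node 3 0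
    0 0 0 (node 6 0 0 0 0 (node 9 0 0 0 0 .nil (node 9 0 0 0 0 (node 9 0 3 0 1 (node 9 0 3 0 4
    .nil (node 6 0 3 0 1 .nil (node 9 0 3 0 3 (node 6 0 3 0 1 .nil (node 6 0 3 0 1 .nil .nil))
    (node 6 0 3 0 1 (node 6 0 3 0 5 .nil .nil) (node 6 0 3 0 1 .nil (node 9 0 3 0 3 (node 6 0
    3 0 1 .nil (node 6 0 3 0 1 .nil .nil)) (node 6 0 3 0 1 (node 7 0 4 0 2 .nil (node 6 0 3 0
    5 .nil (node 6 0 3 0 5 .nil (node 7 0 4 0 2 .nil .nil)))) (node 9 0 3 0 4 .nil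
    .nil)))))))) .nil) .nil)) (node 3 0 0 0 2 .nil (node 3 0 0 0 2 .nil (node 2 0 2 0 3 (node
    0 0 3 0 5 .nil (node (-3) 0 3 0 0 .nil .nil)) .nil)))) (node 0 0 0 0 2 (node (-3) 0 3 0 2
    (node (-6) 0 6 0 2 (node (-9) 0 9 0 2 (node 0 0 3 0 1 (node (-3) 0 6 0 11 .nil (node (-3)
    0 6 0 11 .nil .nil)) (node 0 0 3 0 1 (node (-3) 0 6 0 11 .nil (node (-3) 0 6 0 11 .nil
    .nil)) .nil)) (node (-9) 0 9 0 3 .nil .nil)) (node (-6) 0 6 0 3 .nil .nil)) (node (-3) 0 3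
    0 3 .nil .nil)) (node 0 2 0 (-1) 0 .nil (node 0 0 0 0 3 .nil .nil))))))) .nil, by decide +kernel⟩

/-- The second tile on the side. -/
def secondProblem : Problem where
  outs := [belowPoly, leftPoly]
  inside := insidePoly (hexPoly 4)
  goals := [tileBC 1, tileBA 1, tileCD 3]

theorem secondProblem_run : ∃ F, secondProblem.run F [[tileBC 0]] = true :=
  ⟨node 3 0 0 0 0 (node 3 0 0 0 3 .nil (node 6 0 0 0 0 .nil (node 3 (-1) 0 2 3 .nil (node 3 0
    0 0 2 (node 3 0 3 0 1 (node 4 0 4 0 11 (node 3 3 3 0 1 .nil (node 3 3 3 0 1 .nil .nil))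
    (node 2 0 5 0 3 (node 3 0 3 3 2 .nil (node 3 0 3 3 2 .nil .nil)) .nil)) (node 0 0 3 0 3
    (node (-3) 0 3 0 1 .nil (node (-3) 0 3 0 1 .nil .nil)) .nil)) (node 3 2 0 (-1) 0 .nil
    (node 3 0 0 0 3 .nil .nil)))))) .nil, by decide +kernel⟩

/-- The third tile on the side, if the second one is `tileBA 1`. -/
def thirdProblem : Problem where
  outs := [belowPoly, leftPoly]
  inside := insidePoly (hexPoly 4)
  goals := [tileAB 2]

theorem thirdProblem_run : ∃ F, thirdProblem.run F [[tileBC 0, tileBA 1]] = true :=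
  ⟨node 6 0 0 0 0 (node 6 0 0 0 2 .nil (node 6 0 0 0 2 .nil (node 5 0 2 0 3 (node 3 0 3 0 5
    .nil (node 0 0 3 0 0 .nil .nil)) .nil))) .nil, by decide +kernel⟩

/-- The fourth tile on the side. -/
def fourthProblem : Problem where
  outs := [belowPoly, leftPoly]
  inside := insidePoly (hexPoly 4)
  goals := [tileCB 3, tileCD 3]

/-- The angle `B` of `tileAB 2` at 3 leaves 60°, which only an angle `C` can fill; its two sides
give the two goals. -/
theorem fourthProblem_run : ∃ F, fourthProblem.run F [[tileBC 0, tileBA 1, tileAB 2]] = true :=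
  ⟨node 9 0 0 0 0 .nil .nil, by decide +kernel⟩

/-- There is no fifth tile on the side. -/
def fifthProblem : Problem where
  outs := [belowPoly]
  inside := insidePoly (hexPoly 5)
  goals := [tileCD 4]

/-- Again 60° remain, now at 4, and an angle `C` must go there; the tree refutes the position with
`CB` on the side. -/
theorem fifthProblem_run : ∃ F, fifthProblem.run F [[tileAB 2, tileCB 3]] = true :=
  ⟨node 12 0 0 0 0 (node 12 0 3 0 1 (node 12 0 3 0 4 .nil (node 9 0 3 0 1 .nil (node 12 0 3 0
    3 (node 9 0 3 0 1 .nil (node 9 0 3 0 1 .nil .nil)) (node 9 0 3 0 1 (node 9 0 3 0 5 .nil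
    .nil) (node 9 0 3 0 1 .nil (node 12 0 3 0 3 (node 9 0 3 0 1 .nil (node 9 0 3 0 1 .nil
    .nil)) (node 9 0 3 0 1 (node 10 0 4 0 2 .nil (node 9 0 3 0 5 .nil (node 9 0 3 0 5 .nil
    (node 10 0 4 0 2 .nil .nil)))) (node 12 0 3 0 4 .nil .nil)))))))) .nil) .nil, by decide +kernel⟩

/-- The left side of the flower. -/
def leftSideProblem : Problem where
  outs := [belowPoly, leftPoly]
  inside := insidePoly (hexPoly 4)
  goals := [tileFarLeft]

theorem leftSideProblem_run : ∃ F, leftSideProblem.run F [[tileBC 0, tileBA 1, tileAB 2, tileCB 3]] = true :=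
  ⟨node (-3) 0 3 0 1 (node (-2) 0 4 0 11 .nil (node (-3) 0 3 0 3 .nil (node (-3) 0 3 0 3 .nil
    (node (-6) 0 6 0 2 (node (-9) 0 9 0 2 (node (-9) 0 12 0 11 (node (-9) 0 12 0 2 .nil (node
    (-7) 0 11 0 9 .nil (node (-7) 0 11 0 9 .nil (node (-7) 0 11 0 9 (node (-6) 0 9 0 10 .nil
    (node (-7) 0 11 0 1 .nil (node (-7) 0 11 0 1 .nil (node (-6) 0 9 0 10 .nil .nil)))) (node
    (-7) 0 11 0 9 .nil (node (-7) 0 11 0 9 .nil (node (-7) 0 11 0 9 (node (-6) 0 9 0 10 .nil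
    .nil) (node (-9) 0 12 0 2 .nil .nil)))))))) .nil) (node (-9) 0 9 0 3 .nil .nil)) .nil))))
    .nil, by decide +kernel⟩

/-- The next tile after two tiles of the type `tileBC`. -/
def stripProblem : Problem where
  outs := [belowPoly]
  inside := insidePoly stripPoly
  goals := [tileBC 0, tileCD 0]

theorem stripProblem_run : ∃ F, stripProblem.run F [[tileBC (-2), tileBC (-1)]] = true :=
  ⟨node 0 0 0 0 0 (node 0 0 0 0 3 .nil (node 0 (-1) 0 2 3 .nil (node (-6) 0 3 0 1 (node (-6)
    0 3 0 4 .nil (node (-5) 0 4 0 11 .nil (node (-5) 0 4 0 11 .nil (node (-5) 0 4 0 11 (node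
    (-3) 0 3 0 0 .nil (node (-5) 0 4 0 3 .nil (node (-5) 0 4 0 3 .nil (node (-3) 0 3 0 0 .nil
    .nil)))) (node (-5) 0 4 0 11 .nil (node (-5) 0 4 0 11 .nil (node (-5) 0 4 0 11 (node (-3)
    0 3 0 0 .nil .nil) (node (-6) 0 3 0 4 .nil .nil)))))))) (node (-6) 0 3 0 1 (node (-6) 0 3
    0 4 .nil (node (-5) 0 4 0 11 (node (-3) 0 3 0 10 .nil .nil) (node (-5) 0 4 0 11 (node (-6)
    3 3 0 1 .nil .nil) (node (-5) 0 4 0 11 (node (-3) 0 3 0 10 .nil (node (-5) 0 4 0 3 .nil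
    (node (-3) 0 3 0 10 .nil (node (-5) 0 4 0 3 .nil (node (-5) 0 4 0 3 .nil (node (-3) 0 3 0
    10 .nil (node (-3) 0 3 0 10 .nil (node (-5) 0 4 0 3 .nil (node (-3) 0 3 0 10 .nil
    .nil))))))))) (node (-5) 0 4 0 11 (node (-3) 0 3 0 10 .nil .nil) (node (-5) 0 4 0 11 (node
    (-3) 0 3 0 10 .nil .nil) (node 0 0 0 0 2 (node (-5) 0 4 0 11 .nil (node (-5) 0 4 0 11 .nil
    .nil)) (node (-6) 0 3 0 4 .nil .nil)))))))) (node 0 2 0 (-1) 0 .nil (node 0 0 0 0 3 .nil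
    .nil)))))) .nil, by decide +kernel⟩

/-- A vertex `D` on the side. -/
def straightProblem : Problem where
  outs := [belowPoly]
  inside := fun p k => decide (p = ⟨0, 0, 0, 0⟩) && decide (k = 0)
  goals := []

/-- The angle `D` of 150° leaves 30° on a straight side, less than the smallest angle of the
pentagon. -/
theorem straightProblem_run : ∃ F, straightProblem.run F [[tileCD (-1)]] = true :=
  ⟨node 0 0 0 0 0 .nil .nil, by decide +kernel⟩

/-! ### Lattice coordinates, isometries, and the normal form of a flower -/

/-- First coordinate with respect to the lattice basis `1`, `ζ ^ 2`. -/
noncomputable def cu (z : ℂ) : ℝ := z.re - z.im / √3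

/-- Second coordinate with respect to the lattice basis `1`, `ζ ^ 2`. -/
noncomputable def cv (z : ℂ) : ℝ := 2 * z.im / √3

theorem im_eq (z : ℂ) : z.im = √3 / 2 * cv z := by
  have h : √3 ≠ 0 := by positivity
  simp only [cv]; field_simp

theorem re_eq (z : ℂ) : z.re = cu z + cv z / 2 := by
  have h : √3 ≠ 0 := by positivity
  simp only [cv, cu]; field_simp; ring

theorem cu_add (z w : ℂ) : cu (z + w) = cu z + cu w := by simp only [cu, add_re, add_im]; ring

theorem cv_add (z w : ℂ) : cv (z + w) = cv z + cv w := by simp only [cv, add_im]; ring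

theorem cu_ofReal (x : ℝ) : cu x = x := by simp [cu]

theorem cv_ofReal (x : ℝ) : cv x = 0 := by simp [cv]

/-- The translate of a set. -/
def trans (x : ℂ) (S : Set ℂ) : Set ℂ := (fun z => z + x) '' S

theorem trans_trans (x y : ℂ) (S : Set ℂ) : trans x (trans y S) = trans (x + y) S := by
  rw [trans, trans, Set.image_image, trans]; congr 1; funext z; ring

theorem trans_zero (S : Set ℂ) : trans 0 S = S := by simp [trans]

theorem mem_trans {x z : ℂ} {S : Set ℂ} : z ∈ trans x S ↔ z - x ∈ S := by
  constructor
  · rintro ⟨w, hw, rfl⟩; simpa using hw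
  · intro h; exact ⟨_, h, by simp⟩

theorem conj_image_model (c : Bool) : conj '' model c = model (!c) := by
  cases c
  · rfl
  · simp [model, Set.image_image]

/-- Rigid motions of the plane. -/
theorem exists_isometry_form {f : ℂ → ℂ} (hf : Isometry f) : ∃ a b : ℂ, ‖a‖ = 1 ∧
    ((∀ z, f z = a * z + b) ∨ (∀ z, f z = a * conj z + b)) := by
  obtain ⟨L, hL⟩ : ∃ L : ℂ →ₗᵢ[ℝ] ℂ, ∀ z, f z = L z + f 0 := by
    refine ⟨(hf.affineIsometryOfStrictConvexSpace).linearIsometry, fun z => ?_⟩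
    have := (hf.affineIsometryOfStrictConvexSpace).map_vadd (0 : ℂ) z
    simpa using this
  obtain ⟨a, ha⟩ := linear_isometry_complex (L.toLinearIsometryEquiv rfl)
  refine ⟨a, f 0, Circle.norm_coe a, ?_⟩
  rcases ha with ha | ha
  · left; intro z; rw [hL]
    have := congrArg (fun g => g z) ha
    simp at this; rw [this]
  · right; intro z; rw [hL]
    have := congrArg (fun g => g z) ha
    simp at this; rw [this]

theorem exists_tileSet_image {f : ℂ → ℂ} (hf : Isometry f) {a b : ℂ} (ha : ‖a‖ = 1) (c : Bool) :
    ∃ (a' b' : ℂ) (c' : Bool), ‖a'‖ = 1 ∧ f '' tileSet a b c = tileSet a' b' c' := by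
  obtain ⟨a₁, b₁, h1, h2 | h2⟩ := exists_isometry_form hf
  · refine ⟨a₁ * a, a₁ * b + b₁, c, by simp [h1, ha], ?_⟩
    rw [tileSet, tileSet, Set.image_image]
    congr 1; funext z; rw [h2]; ring
  · refine ⟨a₁ * conj a, a₁ * conj b + b₁, !c, by simp [h1, ha], ?_⟩
    rw [tileSet, tileSet, Set.image_image, ← conj_image_model, Set.image_image]
    congr 1; funext z; rw [h2]; simp only [map_add, map_mul]; ring

theorem IsTiling.image {n : ℕ} {T : Fin n → Set ℂ} {X : Set ℂ} (hT : IsTiling T X) (f : ℂ ≃ᵢ ℂ) :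
    IsTiling (fun i => f '' T i) (f '' X) where
  tile i := by
    obtain ⟨a, b, c, ha, h⟩ := hT.tile i
    rw [h]
    exact exists_tileSet_image f.isometry ha c
  disj i j hij := by
    have e : ∀ S : Set ℂ, interior (f '' S) = f '' interior S := fun S =>
      (f.toHomeomorph.image_interior S).symm
    simp only [e]
    exact (Set.disjoint_image_iff f.injective).mpr (hT.disj hij)
  cover := by rw [← hT.cover, Set.image_iUnion]

theorem IsTiling.trans {n : ℕ} {T : Fin n → Set ℂ} {X : Set ℂ} (hT : IsTiling T X) (x : ℂ) :
    IsTiling (fun i => THTiling.trans x (T i)) (THTiling.trans x X) :=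
  hT.image (IsometryEquiv.addRight x)

theorem IsTiling.congr {n : ℕ} {T : Fin n → Set ℂ} {X Y : Set ℂ} (hT : IsTiling T X) (h : X = Y) :
    IsTiling T Y := h ▸ hT

/-- The normal form of the region in the proof: a flower of side length `s` one of whose outer
sides is the segment from `0` to `s`, with an outer hexagon above it. -/
structure FlowerRegion (s : ℝ) (M : Set ℂ) : Prop where
  hexagon : ∀ z, 0 ≤ cv z → cv z ≤ 2 * s → cu z ≤ s → -s ≤ cu z → 0 ≤ cu z + cv z →
    cu z + cv z ≤ 2 * s → z ∈ M
  below : ∀ z ∈ M, 0 ≤ cv z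
  left : ∀ z ∈ M, cv z < s → 0 ≤ cu z + cv z
  refl : ∀ z ∈ M, (s : ℂ) - conj z ∈ M
  reflDiag : ∀ z ∈ M, (s : ℂ) * zeta ^ 4 + zeta ^ 4 * conj (z - s * zeta ^ 4) ∈ M

theorem sd_even (p : Cyc) (z : ℂ) :
    sd (p, 0) z = √3 / 2 * (cv z - cv p.toC) ∧
    sd (p, 2) z = √3 / 2 * (cu p.toC - cu z) ∧
    sd (p, 4) z = √3 / 2 * (cu p.toC + cv p.toC - (cu z + cv z)) ∧
    sd (p, 6) z = √3 / 2 * (cv p.toC - cv z) ∧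
    sd (p, 8) z = √3 / 2 * (cu z - cu p.toC) ∧
    sd (p, 10) z = √3 / 2 * (cu z + cv z - (cu p.toC + cv p.toC)) := by
  obtain ⟨w, hw⟩ : ∃ w, w = p.toC := ⟨_, rfl⟩
  simp only [sd_eq, ← hw, zeta_pow_eq_toC]
  simp only [Cyc.rot, Cyc.rotOne, Cyc.toC]
  rw [im_eq z, re_eq z, im_eq w, re_eq w]
  push_cast
  refine ⟨?_, ?_, ?_, ?_, ?_, ?_⟩ <;> ring

theorem cu_toC (p : Cyc) : cu p.toC = (p.a + p.b * √3 / 3 - p.d * √3 / 3) / 3 := by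
  have h : √3 * √3 = (3 : ℝ) := Real.mul_self_sqrt (by norm_num)
  have h' : √3 ≠ 0 := by positivity
  simp only [cu, Cyc.toC]
  field_simp
  linear_combination (p.b + 2 * p.d : ℝ) * h

theorem cv_toC (p : Cyc) : cv p.toC = (p.c + (p.b + 2 * p.d) * √3 / 3) / 3 := by
  have h : √3 * √3 = (3 : ℝ) := Real.mul_self_sqrt (by norm_num)
  have h' : √3 ≠ 0 := by positivity
  simp only [cv, Cyc.toC]
  field_simp
  linear_combination (-(p.b + 2 * p.d) : ℝ) * h

theorem sd_odd (p : Cyc) (z : ℂ) :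
    sd (p, 5) z = (cu p.toC + 2 * cv p.toC - (cu z + 2 * cv z)) / 2 ∧
    sd (p, 7) z = (cu z - cv z - (cu p.toC - cv p.toC)) / 2 := by
  have h : √3 * √3 = (3 : ℝ) := Real.mul_self_sqrt (by norm_num)
  obtain ⟨w, hw⟩ : ∃ w, w = p.toC := ⟨_, rfl⟩
  simp only [sd_eq, ← hw, zeta_pow_eq_toC]
  simp only [Cyc.rot, Cyc.rotOne, Cyc.toC]
  rw [im_eq z, re_eq z, im_eq w, re_eq w]
  push_cast
  constructor
  · linear_combination (-(cv z - cv w) / 4) * h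
  · linear_combination (-(cv z - cv w) / 4) * h

theorem sd_pos_dir (p : Cyc) (z : ℂ) :
    (0 < sd (p, 0) z ↔ cv p.toC < cv z) ∧ (0 < sd (p, 2) z ↔ cu z < cu p.toC) ∧
    (0 < sd (p, 4) z ↔ cu z + cv z < cu p.toC + cv p.toC) ∧ (0 < sd (p, 6) z ↔ cv z < cv p.toC) ∧
    (0 < sd (p, 8) z ↔ cu p.toC < cu z) ∧
    (0 < sd (p, 10) z ↔ cu p.toC + cv p.toC < cu z + cv z) ∧
    (0 < sd (p, 5) z ↔ cu z + 2 * cv z < cu p.toC + 2 * cv p.toC) ∧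
    (0 < sd (p, 7) z ↔ cu p.toC - cv p.toC < cu z - cv z) := by
  have h3 : 0 < √3 / 2 := by positivity
  obtain ⟨e0, e2, e4, e6, e8, e10⟩ := sd_even p z
  obtain ⟨e5, e7⟩ := sd_odd p z
  rw [e0, e2, e4, e6, e8, e10, e5, e7]
  simp only [mul_pos_iff_of_pos_left h3, sub_pos, div_pos_iff_of_pos_right (two_pos (α := ℝ)),
    and_self]

theorem insidePoly_sound {P : Poly} {X : Set ℂ} (h : P.inner ⊆ X) (p : Cyc) (k : ℕ)
    (hp : insidePoly P p k = true) (η : ℝ) (hη : 0 < η) (_ : η < 1) :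
    ∀ᶠ r : ℝ in 𝓝[>] 0, p.toC + r * (zeta ^ k + η * bis k) ∈ X := by
  rw [insidePoly, Bool.and_eq_true] at hp
  filter_upwards [closedDir_sound hp.1 hp.2 hη] with r hr using h hr

theorem Problem.run_known {pr : Problem} {X : Set ℂ} {n : ℕ} {T : Fin n → Set ℂ}
    (hs : pr.Sound X) (hT : IsTiling T X) {known : List Placement}
    (hr : ∃ F, pr.run F [known] = true) (hk : ∀ N ∈ known, Known T N) :
    ∃ G ∈ pr.goals, Known T G := by
  obtain ⟨F, hF⟩ := hr
  exact Problem.run_sound hs hT F _ hF known (by simp) hk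

theorem tileSet_add (a b w : ℂ) (c : Bool) : tileSet a (b + w) c = trans w (tileSet a b c) := by
  rw [tileSet, tileSet, trans, Set.image_image]
  congr 1; funext z; ring

theorem Placement.set_trans (N : Placement) (q : Cyc) :
    (⟨N.pos.add q, N.dir, N.flip⟩ : Placement).set = trans q.toC N.set := by
  rw [Placement.set, Placement.set, ← tileSet_add, Cyc.toC_add]

theorem toC_ofInt (x : ℤ) : (⟨3 * x, 0, 0, 0⟩ : Cyc).toC = x := by
  apply Complex.ext <;> simp [Cyc.toC]

theorem tileBC_set (x : ℤ) : (tileBC x).set = trans x (tileBC 0).set := by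
  rw [← toC_ofInt, ← Placement.set_trans]
  simp only [tileBC, Cyc.add]
  congr 3
  all_goals ring

theorem tileCD_set (x : ℤ) : (tileCD x).set = trans (x + 1) (tileCD (-1)).set := by
  have := (tileCD (-1)).set_trans ⟨3 * (x + 1), 0, 0, 0⟩
  rw [toC_ofInt] at this
  push_cast at this
  rw [← this]
  simp only [tileCD, Cyc.add]
  congr 3
  all_goals ring

theorem Placement.mem_set_of_closedMem {N : Placement} {p : Cyc} (h : closedMem N.poly p = true) :
    p.toC ∈ N.set := by
  rw [Placement.set_eq]
  intro g hg
  simp only [closedMem, List.all_eq_true, Bool.or_eq_true] at h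
  have := h g hg
  rw [sd_pos_iff, sd_zero_iff] at this
  rcases this with h1 | h1
  · exact h1.le
  · exact h1.ge

theorem Placement.not_mem_set_of_closedMem {N : Placement} {p : Cyc}
    (h : closedMem N.poly p = false) : p.toC ∉ N.set := by
  rw [Placement.set_eq]
  intro hm
  simp only [closedMem, List.all_eq_false, Bool.or_eq_true, not_or] at h
  obtain ⟨g, hg, h1, h2⟩ := h
  rw [sd_pos_iff] at h1
  rw [sd_zero_iff] at h2
  exact h2 (le_antisymm (not_lt.mp h1) (hm g hg))

theorem Placement.mem_interior_of_all {N : Placement} {p : Cyc}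
    (h : (N.poly.all fun g => posRt (sdPair g p)) = true) : p.toC ∈ interior N.set := by
  apply N.inner_subset
  intro g hg
  rw [← sd_pos_iff]
  exact List.all_eq_true.mp h g hg

/-- The reflection in the perpendicular bisector of the segment from `0` to `s`. -/
noncomputable def reflEquiv (s : ℝ) : ℂ ≃ᵢ ℂ :=
  (conjLIE.toIsometryEquiv).trans (IsometryEquiv.subLeft (s : ℂ))

theorem reflEquiv_apply (s : ℝ) (z : ℂ) : reflEquiv s z = s - conj z := by
  simp [reflEquiv]

theorem reflEquiv_invol (s : ℝ) (z : ℂ) : reflEquiv s (reflEquiv s z) = z := by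
  simp [reflEquiv_apply]

theorem cu_refl (s : ℝ) (z : ℂ) : cu (reflEquiv s z) = s - (cu z + cv z) := by
  simp only [reflEquiv_apply, cu, cv, sub_re, sub_im, ofReal_re, ofReal_im, conj_re, conj_im]
  ring

theorem cv_refl (s : ℝ) (z : ℂ) : cv (reflEquiv s z) = cv z := by
  simp only [reflEquiv_apply, cv, sub_im, ofReal_im, conj_im]; ring

/-- The reflection in the line through `s ζ ^ 4` with direction `ζ ^ 2`. -/
noncomputable def diagMap (s : ℝ) (z : ℂ) : ℂ := s * zeta ^ 4 + zeta ^ 4 * conj (z - s * zeta ^ 4)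

theorem diagMap_invol (s : ℝ) : Function.Involutive (diagMap s) := by
  intro z
  have h4 := conj_mul_self_of_norm (norm_zeta_pow 4)
  simp only [diagMap]
  rw [show (s : ℂ) * zeta ^ 4 + zeta ^ 4 * conj (z - s * zeta ^ 4) - s * zeta ^ 4
    = zeta ^ 4 * conj (z - s * zeta ^ 4) by ring, map_mul, conj_conj]
  linear_combination (z - s * zeta ^ 4) * h4

noncomputable def diagEquiv (s : ℝ) : ℂ ≃ᵢ ℂ where
  toEquiv := (diagMap_invol s).toPerm
  isometry_toFun := by
    apply Isometry.of_dist_eq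
    intro x y
    change dist (diagMap s x) (diagMap s y) = _
    rw [dist_eq_norm, dist_eq_norm, diagMap, diagMap,
      show (s : ℂ) * zeta ^ 4 + zeta ^ 4 * conj (x - s * zeta ^ 4)
        - (s * zeta ^ 4 + zeta ^ 4 * conj (y - s * zeta ^ 4)) = zeta ^ 4 * conj (x - y) by
        simp only [map_sub]; ring, norm_mul, norm_zeta_pow, RCLike.norm_conj, one_mul]

theorem image_eq_of_invol {f : ℂ → ℂ} (hf : Function.Involutive f) {S : Set ℂ}
    (h : ∀ z ∈ S, f z ∈ S) : f '' S = S := by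
  apply Set.Subset.antisymm
  · rintro _ ⟨z, hz, rfl⟩; exact h z hz
  · intro z hz; exact ⟨f z, h z hz, hf z⟩

section

variable {s : ℝ} {M : Set ℂ}

theorem FlowerRegion.right (hM : FlowerRegion s M) {z : ℂ} (hz : z ∈ M) (h : cv z < s) :
    cu z ≤ s := by
  have h1 := hM.refl z hz
  rw [← reflEquiv_apply] at h1
  have := hM.left _ h1 (by rwa [cv_refl])
  rw [cu_refl, cv_refl] at this
  linarith

theorem mem_inner_hexPoly {m : ℤ} {z : ℂ} (h : z ∈ (hexPoly m).inner) :
    0 < cv z ∧ cv z < 2 * m ∧ cu z < m ∧ -m < cu z ∧ 0 < cu z + cv z ∧ cu z + cv z < 2 * m := by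
  simp only [Poly.inner, hexPoly, Set.mem_ofPred_eq, List.forall_mem_cons, sd_pos_dir, cu_toC,
    cv_toC, pt, Cyc.rot, Cyc.rotOne, Cyc.add] at h
  push_cast at h
  obtain ⟨h1, h2, h3, h4, h5, h6, -⟩ := h
  refine ⟨?_, ?_, ?_, ?_, ?_, ?_⟩ <;> linarith

theorem FlowerRegion.hexPoly_subset (hM : FlowerRegion s M) {m : ℤ} (hm : (m : ℝ) ≤ s) :
    (hexPoly m).inner ⊆ M := by
  intro z hz
  obtain ⟨h1, h2, h3, h4, h5, h6⟩ := mem_inner_hexPoly hz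
  apply hM.hexagon <;> linarith

theorem mem_inner_belowPoly {z : ℂ} : z ∈ belowPoly.inner ↔ cv z < 0 := by
  simp [Poly.inner, belowPoly, sd_pos_dir, cv_toC]

theorem mem_inner_leftPoly {z : ℂ} : z ∈ leftPoly.inner ↔ cu z + cv z < 0 ∧ cv z < 4 := by
  simp [Poly.inner, leftPoly, sd_pos_dir, cv_toC, cu_toC, pt, Cyc.rot, Cyc.rotOne]
  norm_num

theorem FlowerRegion.disjoint_below (hM : FlowerRegion s M) : Disjoint belowPoly.inner M := by
  rw [Set.disjoint_left]
  intro z hz hzM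
  exact absurd (hM.below z hzM) (not_le.mpr (mem_inner_belowPoly.mp hz))

theorem FlowerRegion.disjoint_left (hM : FlowerRegion s M) (hs : 4 ≤ s) :
    Disjoint leftPoly.inner M := by
  rw [Set.disjoint_left]
  intro z hz hzM
  rw [mem_inner_leftPoly] at hz
  linarith [hM.left z hzM (by linarith)]

theorem FlowerRegion.disjoint_outs (hM : FlowerRegion s M) (hs : 4 ≤ s) :
    ∀ P ∈ [belowPoly, leftPoly], Disjoint P.inner M := by
  intro P hP
  simp only [List.mem_cons, List.not_mem_nil, or_false] at hP
  rcases hP with rfl | rfl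
  · exact hM.disjoint_below
  · exact hM.disjoint_left hs

theorem FlowerRegion.hex_sound (hM : FlowerRegion s M) (hs : 4 ≤ s) (goals : List Placement) :
    (⟨[belowPoly, leftPoly], insidePoly (hexPoly 4), goals⟩ : Problem).Sound M where
  outs := hM.disjoint_outs hs
  inside := insidePoly_sound (hM.hexPoly_subset (by exact_mod_cast hs))

theorem disjoint_below_trans (hM : FlowerRegion s M) (x : ℝ) :
    ∀ P ∈ [belowPoly], Disjoint P.inner (trans (-(x : ℂ)) M) := by
  intro P hP
  rw [List.mem_singleton.mp hP, Set.disjoint_left]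
  intro z hz hzM
  rw [mem_trans] at hzM
  have h1 := hM.below _ hzM
  rw [mem_inner_belowPoly] at hz
  rw [sub_neg_eq_add, cv_add, cv_ofReal] at h1
  linarith

variable {n : ℕ} {T : Fin n → Set ℂ}

/-! ### Tiles forced along a side -/

/-- No vertex `D` lies on a side, if the edge `CD` is on the side. -/
theorem IsTiling.no_vertex_D (hM : FlowerRegion s M) (hs : 4 ≤ s) (hT : IsTiling T M) {x : ℝ}
    (hx : 1 ≤ x) (i : Fin n) : T i ≠ THTiling.trans x (tileCD (-1)).set := by
  intro hi
  rcases lt_or_ge x s with hxs | hxs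
  -- The real number `x` may be arbitrarily close to `s`, so no fixed polygon fits in the region;
  -- one probe at the origin needs only the germ of the sector there.
  · have hsound : straightProblem.Sound (THTiling.trans (-(x : ℂ)) M) := by
      refine ⟨disjoint_below_trans hM x, ?_⟩
      intro p k hpk η hη hη1
      simp only [straightProblem, Bool.and_eq_true, decide_eq_true_eq] at hpk
      obtain ⟨rfl, rfl⟩ := hpk
      have hw : cv (zeta ^ 0 + η * bis 0) = η / √3 := by
        simp [cv, bis, zeta]; ring
      obtain ⟨w, hww⟩ : ∃ w, w = zeta ^ 0 + η * bis 0 := ⟨_, rfl⟩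
      rw [← hww] at hw ⊢
      have hr0 : ∀ᶠ r : ℝ in 𝓝[>] 0, (0:ℝ) < r := self_mem_nhdsWithin
      have e1 := eventually_pos_of_lex (s := 2 * s) (d := - cv w) (Or.inl (by linarith))
      have e2 := eventually_pos_of_lex (s := s - x) (d := - cu w) (Or.inl (by linarith))
      have e3 := eventually_pos_of_lex (s := s + x) (d := cu w) (Or.inl (by linarith))
      have e4 := eventually_pos_of_lex (s := x) (d := cu w + cv w) (Or.inl (by linarith))
      have e5 := eventually_pos_of_lex (s := 2 * s - x) (d := - (cu w + cv w)) (Or.inl (by linarith))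
      filter_upwards [hr0, e1, e2, e3, e4, e5] with r h0 h1 h2 h3 h4 h5
      rw [mem_trans]
      have hz : (⟨0, 0, 0, 0⟩ : Cyc).toC = 0 := by apply Complex.ext <;> simp [Cyc.toC]
      rw [hz, zero_add, sub_neg_eq_add]
      have c1 : cu (r * w + x) = r * cu w + x := by
        rw [cu_add, cu_ofReal]; simp [cu]; ring
      have c2 : cv (r * w + x) = r * cv w := by
        rw [cv_add, cv_ofReal]; simp [cv]; ring
      have h6 : 0 ≤ r * cv w := by rw [hw]; positivity
      apply hM.hexagon <;> simp only [c1, c2] <;> linarith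
    obtain ⟨G, hG, -⟩ := Problem.run_known hsound (hT.trans (-(x : ℂ))) straightProblem_run (by
      intro N hN
      rw [List.mem_singleton] at hN
      subst hN
      refine ⟨i, ?_⟩
      change THTiling.trans _ (T i) = _
      rw [hi, trans_trans]; simp [trans_zero])
    simp [straightProblem] at hG
  -- This point is the vertex `E`. After translation its first coordinate is `x + 1/3 > s`, beyond
  -- the right side.
  · have h1 : (⟨1, 0, 1, 0⟩ : Cyc).toC ∈ (tileCD (-1)).set :=
      Placement.mem_set_of_closedMem (by decide)
    have h2 : (⟨1, 0, 1, 0⟩ : Cyc).toC + x ∈ M := by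
      apply hT.subset i
      rw [hi, mem_trans]; simpa using h1
    have h3 := hM.right h2 (by rw [cv_add, cv_ofReal, cv_toC]; push_cast; linarith)
    rw [cu_add, cu_ofReal, cu_toC] at h3
    push_cast at h3
    linarith

theorem IsTiling.not_known_CD (hM : FlowerRegion s M) (hs : 4 ≤ s) (hT : IsTiling T M) {x : ℤ}
    (hx : 0 ≤ x) : ¬ Known T (tileCD x) := by
  rintro ⟨i, hi⟩
  have hx' : (0:ℝ) ≤ x := by exact_mod_cast hx
  refine hT.no_vertex_D hM hs (x := x + 1) (by linarith) i ?_
  rw [hi, tileCD_set]; push_cast; rfl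

theorem IsTiling.known_BC_zero (hM : FlowerRegion s M) (hs : 4 ≤ s) (hT : IsTiling T M) :
    Known T (tileBC 0) := by
  obtain ⟨G, hG, hk⟩ := Problem.run_known (hM.hex_sound hs _) hT cornerProblem_run (by simp)
  simp only [List.mem_cons, List.not_mem_nil, or_false] at hG
  rcases hG with rfl | rfl
  · exact hk
  · exact absurd hk (hT.not_known_CD hM hs (by norm_num))

theorem IsTiling.known_second (hM : FlowerRegion s M) (hs : 4 ≤ s) (hT : IsTiling T M) :
    Known T (tileBC 1) ∨ Known T (tileBA 1) := by
  obtain ⟨G, hG, hk⟩ := Problem.run_known (hM.hex_sound hs _) hT secondProblem_run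
    (by simpa using hT.known_BC_zero hM hs)
  simp only [List.mem_cons, List.not_mem_nil, or_false] at hG
  rcases hG with rfl | rfl | rfl
  · exact Or.inl hk
  · exact Or.inr hk
  · exact absurd hk (hT.not_known_CD hM hs (by norm_num))

theorem IsTiling.known_four (hM : FlowerRegion s M) (hs : 4 ≤ s) (hT : IsTiling T M)
    (h : Known T (tileBA 1)) :
    ∀ N ∈ [tileBC 0, tileBA 1, tileAB 2, tileCB 3], Known T N := by
  have h0 := hT.known_BC_zero hM hs
  have h2 : Known T (tileAB 2) := by
    obtain ⟨G, hG, hk⟩ := Problem.run_known (hM.hex_sound hs _) hT thirdProblem_run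
      (by simpa using ⟨h0, h⟩)
    simp only [List.mem_cons, List.not_mem_nil, or_false] at hG
    rwa [hG] at hk
  have h3 : Known T (tileCB 3) := by
    obtain ⟨G, hG, hk⟩ := Problem.run_known (hM.hex_sound hs _) hT fourthProblem_run
      (by simpa using ⟨h0, h, h2⟩)
    simp only [List.mem_cons, List.not_mem_nil, or_false] at hG
    rcases hG with rfl | rfl
    · exact hk
    · exact absurd hk (hT.not_known_CD hM hs (by norm_num))
  simpa using ⟨h0, h, h2, h3⟩

theorem mem_inner_stripPoly {z : ℂ} (h : z ∈ stripPoly.inner) :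
    0 < cv z ∧ cu z < 1 ∧ cv z < 4 ∧ -2 < cu z + cv z := by
  simp only [Poly.inner, stripPoly, Set.mem_ofPred_eq, List.forall_mem_cons, sd_pos_dir, cu_toC,
    cv_toC, pt, Cyc.rot, Cyc.rotOne] at h
  push_cast at h
  obtain ⟨h1, h2, h3, h4, -⟩ := h
  refine ⟨?_, ?_, ?_, ?_⟩ <;> linarith

/-- Translation by `-x` brings the two given tiles into the position of `stripProblem`; its other
outcome puts a vertex `D` at `x + 1`. The bound `x + 1 ≤ s` keeps the strip inside the hexagon. -/
theorem IsTiling.next_BC (hM : FlowerRegion s M) (hs : 4 ≤ s) (hT : IsTiling T M) {x : ℝ}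
    (hx : 2 ≤ x) (hx' : x + 1 ≤ s)
    (h1 : ∃ i, T i = THTiling.trans ((x - 2 : ℝ) : ℂ) (tileBC 0).set)
    (h2 : ∃ i, T i = THTiling.trans ((x - 1 : ℝ) : ℂ) (tileBC 0).set) :
    ∃ i, T i = THTiling.trans (x : ℂ) (tileBC 0).set := by
  have hsound : stripProblem.Sound (THTiling.trans (-(x : ℂ)) M) := by
    refine ⟨disjoint_below_trans hM x, insidePoly_sound ?_⟩
    intro z hz
    obtain ⟨g1, g2, g3, g4⟩ := mem_inner_stripPoly hz
    rw [mem_trans, sub_neg_eq_add]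
    apply hM.hexagon <;> simp only [cu_add, cv_add, cu_ofReal, cv_ofReal] <;> linarith
  obtain ⟨i, hi⟩ := h1
  obtain ⟨j, hj⟩ := h2
  obtain ⟨G, hG, l, hk⟩ := Problem.run_known hsound (hT.trans (-(x : ℂ))) stripProblem_run (by
    intro N hN
    simp only [List.mem_cons, List.not_mem_nil, or_false] at hN
    rcases hN with rfl | rfl
    · refine ⟨i, ?_⟩
      change THTiling.trans _ (T i) = _
      rw [hi, trans_trans, tileBC_set (-2)]; congr 1; push_cast; ring
    · refine ⟨j, ?_⟩
      change THTiling.trans _ (T j) = _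
      rw [hj, trans_trans, tileBC_set (-1)]; congr 1; push_cast; ring)
  have back : ∀ S, THTiling.trans (-(x : ℂ)) (T l) = S → T l = THTiling.trans (x : ℂ) S := by
    rintro S rfl
    rw [trans_trans]; simp [trans_zero]
  simp only [stripProblem, List.mem_cons, List.not_mem_nil, or_false] at hG
  rcases hG with rfl | rfl
  · exact ⟨l, back _ hk⟩
  · exfalso
    have := back _ hk
    rw [tileCD_set, trans_trans] at this
    refine hT.no_vertex_D hM hs (x := x + 1) (by linarith) l ?_
    rw [this]; congr 1; push_cast; ring

theorem IsTiling.all_BC (hM : FlowerRegion s M) (hs : 4 ≤ s) (hT : IsTiling T M)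
    (h : Known T (tileBC 1)) (j : ℕ) (hj : (j : ℝ) + 2 ≤ s) :
    (∃ i, T i = THTiling.trans ((j : ℝ) : ℂ) (tileBC 0).set) ∧
      ∃ i, T i = THTiling.trans ((j + 1 : ℝ) : ℂ) (tileBC 0).set := by
  induction j with
  | zero =>
    obtain ⟨i, hi⟩ := hT.known_BC_zero hM hs
    obtain ⟨l, hl⟩ := h
    refine ⟨⟨i, by rw [hi]; simp [trans_zero]⟩, ⟨l, ?_⟩⟩
    rw [hl, tileBC_set]; simp
  | succ j ih =>
    push_cast at hj ⊢
    obtain ⟨h1, h2⟩ := ih (by linarith)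
    have h0 : (0:ℝ) ≤ j := Nat.cast_nonneg j
    have := hT.next_BC hM hs (x := j + 2) (by linarith) (by linarith)
      (by simpa using h1) (by convert h2 using 4; norm_num; ring)
    refine ⟨by simpa using h2, ?_⟩
    convert this using 4
    push_cast; ring

theorem mem_inner_BC {z : ℂ} : z ∈ (tileBC 0).poly.inner ↔
    0 < cu z + cv z ∧ 0 < cv z ∧ cu z + cv z < 1 ∧ cu z + 2 * cv z < 2 ∧ -2 < cu z - cv z := by
  have : (tileBC 0).poly = [(⟨-3, 0, 3, 0⟩, 10), (⟨0, 0, 0, 0⟩, 0), (⟨3, 0, 0, 0⟩, 4),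
    (⟨0, 0, 3, 0⟩, 5), (⟨-2, 0, 4, 0⟩, 7)] := by decide
  simp only [this, Poly.inner, Set.mem_ofPred_eq, List.forall_mem_cons, sd_pos_dir, cu_toC,
    cv_toC, List.not_mem_nil, false_implies, implies_true, and_true]
  push_cast
  norm_num

theorem mem_inner_CB {z : ℂ} : z ∈ (tileCB 3).poly.inner ↔
    cu z < 4 ∧ 0 < cv z ∧ 3 < cu z ∧ 2 < cu z - cv z ∧ cu z + 2 * cv z < 6 := by
  have : (tileCB 3).poly = [(⟨12, 0, 0, 0⟩, 2), (⟨9, 0, 0, 0⟩, 0), (⟨9, 0, 3, 0⟩, 8),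
    (⟨10, 0, 4, 0⟩, 7), (⟨12, 0, 3, 0⟩, 5)] := by decide
  simp only [this, Poly.inner, Set.mem_ofPred_eq, List.forall_mem_cons, sd_pos_dir, cu_toC,
    cv_toC, List.not_mem_nil, false_implies, implies_true, and_true]
  push_cast
  norm_num

end

section

variable {s : ℝ} {M : Set ℂ} {n : ℕ} {T : Fin n → Set ℂ}

theorem image_interior_isometryEquiv (f : ℂ ≃ᵢ ℂ) (S : Set ℂ) :
    interior (f '' S) = f '' interior S :=
  (f.toHomeomorph.image_interior S).symm

theorem image_image_invol {f : ℂ → ℂ} (hf : Function.Involutive f) (S : Set ℂ) :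
    f '' (f '' S) = S := by
  rw [Set.image_image]; simp [hf _]

theorem FlowerRegion.image_refl (hM : FlowerRegion s M) : reflEquiv s '' M = M :=
  image_eq_of_invol (reflEquiv_invol s) fun z hz => by
    rw [reflEquiv_apply]; exact hM.refl z hz

theorem FlowerRegion.image_diag (hM : FlowerRegion s M) : diagEquiv s '' M = M :=
  image_eq_of_invol (diagMap_invol s) fun z hz => hM.reflDiag z hz

/-- The tile at the right end of the side. -/
theorem IsTiling.right_tile (hM : FlowerRegion s M) (hs : 4 ≤ s) (hT : IsTiling T M) :
    ∃ i, T i = reflEquiv s '' (tileBC 0).set := by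
  obtain ⟨i, hi⟩ := ((hT.image (reflEquiv s)).congr hM.image_refl).known_BC_zero hM hs
  refine ⟨i, ?_⟩
  rw [← hi]
  exact (image_image_invol (reflEquiv_invol s) (T i)).symm

theorem mem_interior_right {z : ℂ} (h1 : cu z < s) (h2 : 0 < cv z) (h3 : s < cu z + 1)
    (h4 : cv z < 1 / 2) : z ∈ interior (reflEquiv s '' (tileBC 0).set) := by
  rw [image_interior_isometryEquiv]
  refine ⟨reflEquiv s z, ?_, reflEquiv_invol s z⟩
  apply Placement.inner_subset
  rw [mem_inner_BC, cu_refl, cv_refl]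
  refine ⟨?_, ?_, ?_, ?_, ?_⟩ <;> linarith

/-- A vertex of the tile at the right end of the side. -/
theorem exists_mem_right (s : ℝ) : ∃ z ∈ reflEquiv s '' (tileBC 0).set, cu z = s ∧ cv z = 1 := by
  have h : (⟨-3, 0, 3, 0⟩ : Cyc).toC ∈ (tileBC 0).set :=
    Placement.mem_set_of_closedMem (by decide)
  refine ⟨_, Set.mem_image_of_mem _ h, ?_, ?_⟩
  · rw [cu_refl, cu_toC, cv_toC]; push_cast; ring
  · rw [cv_refl, cv_toC]; push_cast; ring

theorem exists_cu_cv (x y : ℝ) : ∃ z : ℂ, cu z = x ∧ cv z = y := by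
  have h : √3 ≠ 0 := by positivity
  refine ⟨⟨x + y / 2, √3 / 2 * y⟩, ?_, ?_⟩
  · simp only [cu]; field_simp; ring
  · simp only [cv]; field_simp

theorem mem_set_BC_le {z : ℂ} (h : z ∈ (tileBC 0).set) : cu z + cv z ≤ 1 := by
  rw [Placement.set_eq] at h
  have h1 := h (⟨3, 0, 0, 0⟩, 4) (by decide)
  have h2 := (sd_pos_dir (⟨3, 0, 0, 0⟩ : Cyc) z).2.2.1
  rw [(sd_even _ _).2.2.1] at h1
  have h3 : 0 < √3 / 2 := by positivity
  have := nonneg_of_mul_nonneg_right h1 h3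
  rw [cu_toC, cv_toC] at this
  push_cast at this
  linarith

theorem mem_set_CB_le {z : ℂ} (h : z ∈ (tileCB 3).set) : cu z ≤ 4 := by
  rw [Placement.set_eq] at h
  have h1 := h (⟨12, 0, 0, 0⟩, 2) (by decide)
  rw [(sd_even _ _).2.1] at h1
  have h3 : 0 < √3 / 2 := by positivity
  have := nonneg_of_mul_nonneg_right h1 h3
  rw [cu_toC] at this
  push_cast at this
  linarith

/-- Copies with the edge `BC` on the side would follow one another up to the last complete unit
segment. The final copy overlaps the tile at the right end, which is a mirror image in another
position. -/
theorem IsTiling.not_known_BC_one (hM : FlowerRegion s M) (hs : 4 ≤ s) (hT : IsTiling T M) :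
    ¬ Known T (tileBC 1) := by
  intro h
  obtain ⟨m, hm⟩ : ∃ m : ℕ, (m : ℝ) + 2 ≤ s ∧ s < m + 3 := by
    refine ⟨⌊s⌋₊ - 2, ?_⟩
    have h1 := Nat.floor_le (show 0 ≤ s by linarith)
    have h2 := Nat.lt_floor_add_one s
    have h3 : 2 ≤ ⌊s⌋₊ := Nat.le_floor (by norm_num; linarith)
    push_cast [Nat.cast_sub h3]
    constructor <;> linarith
  obtain ⟨-, i, hi⟩ := hT.all_BC hM hs h m hm.1
  obtain ⟨l, hl⟩ := hT.right_tile hM hs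
  -- The first coordinate is midway between `m + 1` and `s`; the height is positive because `s < m +
  -- 3`, and small enough for the point to be interior to both tiles.
  obtain ⟨z, hzu, hzv⟩ := exists_cu_cv ((s + m + 1) / 2) ((m + 3 - s) / 4)
  have h1 : z ∈ interior (T l) := by
    rw [hl]
    apply mem_interior_right <;> first | (rw [hzu]; linarith) | (rw [hzv]; linarith)
  have h2 : z ∈ interior (T i) := by
    have e : THTiling.trans ((m + 1 : ℝ) : ℂ) (tileBC 0).set
        = IsometryEquiv.addRight ((m + 1 : ℝ) : ℂ) '' (tileBC 0).set := rfl
    rw [hi, e, image_interior_isometryEquiv]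
    refine ⟨z + ((-(m + 1) : ℝ) : ℂ), ?_, by simp; ring⟩
    apply Placement.inner_subset
    rw [mem_inner_BC, cu_add, cv_add, cu_ofReal, cv_ofReal, hzu, hzv]
    refine ⟨?_, ?_, ?_, ?_, ?_⟩ <;> linarith
  have hil := hT.eq_of_mem h2 h1
  -- The vertex `A` of the right tile has `cu + cv = s + 1`, while the other tile stays within `cu +
  -- cv ≤ m + 2 ≤ s`.
  obtain ⟨w, hw, hwu, hwv⟩ := exists_mem_right s
  rw [← hl, ← hil, hi, mem_trans] at hw
  have := mem_set_BC_le hw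
  rw [sub_eq_add_neg, ← ofReal_neg, cu_add, cv_add, cu_ofReal, cv_ofReal, hwu, hwv] at this
  linarith

/-- The forced `tileCB 3` ends at 4. If `s < 5` it overlaps the tile at the right end, which reaches
`cu = s > 4`; if `s ≥ 5` the fifth search forces a vertex `D` at 5. -/
theorem IsTiling.not_lt_side (hM : FlowerRegion s M) (hs : 4 < s) (hT : IsTiling T M) : False := by
  have hBA := (hT.known_second hM hs.le).resolve_left (hT.not_known_BC_one hM hs.le)
  have hfour := hT.known_four hM hs.le hBA
  rcases lt_or_ge s 5 with h5 | h5
  · obtain ⟨i, hi⟩ := hfour (tileCB 3) (by simp)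
    obtain ⟨l, hl⟩ := hT.right_tile hM hs.le
    obtain ⟨z, hzu, hzv⟩ := exists_cu_cv ((s + 3) / 2) (1 / 4)
    have h1 : z ∈ interior (T l) := by
      rw [hl]
      apply mem_interior_right <;> first | (rw [hzu]; linarith) | (rw [hzv]; linarith)
    have h2 : z ∈ interior (T i) := by
      rw [hi]
      apply Placement.inner_subset
      rw [mem_inner_CB, hzu, hzv]
      refine ⟨?_, ?_, ?_, ?_, ?_⟩ <;> linarith
    have hil := hT.eq_of_mem h2 h1
    obtain ⟨w, hw, hwu, -⟩ := exists_mem_right s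
    rw [← hl, ← hil, hi] at hw
    have := mem_set_CB_le hw
    linarith
  · have hsound : fifthProblem.Sound M := by
      refine ⟨?_, insidePoly_sound (hM.hexPoly_subset (by exact_mod_cast h5))⟩
      intro P hP
      rw [List.mem_singleton.mp hP]
      exact hM.disjoint_below
    obtain ⟨G, hG, hk⟩ := Problem.run_known hsound hT fifthProblem_run (by
      intro N hN
      exact hfour N (by simp at hN ⊢; tauto))
    rw [List.mem_singleton.mp hG] at hk
    exact hT.not_known_CD hM hs.le (by norm_num) hk

theorem IsTiling.known_farLeft (hM : FlowerRegion 4 M) (hT : IsTiling T M) :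
    Known T tileFarLeft := by
  have hBA := (hT.known_second hM le_rfl).resolve_left (hT.not_known_BC_one hM le_rfl)
  obtain ⟨G, hG, hk⟩ := Problem.run_known (hM.hex_sound le_rfl _) hT leftSideProblem_run
    (hT.known_four hM le_rfl hBA)
  rwa [List.mem_singleton.mp hG] at hk

/-- The first point lies on the axis just above the reentrant corner `4 ζ ^ 4`, inside
`tileFarLeft`. The second is the vertex `C` of that tile, whose mirror image is not in the tile.
Hence the tile and its reflection overlap but are different. -/
theorem diagMap_toC :
    diagMap 4 (⟨-12, 0, 13, 0⟩ : Cyc).toC = (⟨-12, 0, 13, 0⟩ : Cyc).toC ∧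
    diagMap 4 (⟨-9, 0, 9, 0⟩ : Cyc).toC = (⟨-15, 0, 12, 0⟩ : Cyc).toC := by
  have h : √3 * √3 = (3 : ℝ) := Real.mul_self_sqrt (by norm_num)
  have h4 : zeta ^ 4 = ⟨-1 / 2, √3 / 2⟩ := by
    rw [zeta_pow_eq_toC]
    apply Complex.ext <;> simp [Cyc.rot, Cyc.rotOne, Cyc.toC] <;> ring
  simp only [diagMap, h4, Cyc.toC]
  constructor <;> apply Complex.ext <;> simp <;> first | ring1 | nlinarith

/-- There is no tiling of a flower with side length at least 4. -/
theorem FlowerRegion.not_isTiling (hM : FlowerRegion s M) (hs : 4 ≤ s) (hT : IsTiling T M) :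
    False := by
  rcases hs.lt_or_eq with h | rfl
  · exact hT.not_lt_side hM h
  · obtain ⟨i, hi⟩ := hT.known_farLeft hM
    obtain ⟨l, hl⟩ := ((hT.image (diagEquiv 4)).congr hM.image_diag).known_farLeft hM
    have hl' : T l = diagEquiv 4 '' tileFarLeft.set := by
      rw [← hl]
      exact (image_image_invol (diagMap_invol 4) (T l)).symm
    have hp : (⟨-12, 0, 13, 0⟩ : Cyc).toC ∈ interior tileFarLeft.set :=
      Placement.mem_interior_of_all (by decide)
    have h1 : (⟨-12, 0, 13, 0⟩ : Cyc).toC ∈ interior (T i) := by rwa [hi]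
    have h2 : (⟨-12, 0, 13, 0⟩ : Cyc).toC ∈ interior (T l) := by
      rw [hl', image_interior_isometryEquiv]
      exact ⟨_, hp, diagMap_toC.1⟩
    have hil := hT.eq_of_mem h1 h2
    have h3 : (⟨-9, 0, 9, 0⟩ : Cyc).toC ∈ tileFarLeft.set :=
      Placement.mem_set_of_closedMem (by decide)
    have h4 : (⟨-15, 0, 12, 0⟩ : Cyc).toC ∈ tileFarLeft.set := by
      rw [← hi, hil, hl']
      exact ⟨_, h3, diagMap_toC.2⟩
    exact Placement.not_mem_set_of_closedMem (by decide) h4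

end

/-! ### Lattice triangles, their thirds, and the pieces of a tile -/

/-- A triangle of the unit triangular lattice: half of the cell with corner `(a, b)`, with its
horizontal side at the bottom, or at the top if `down` is set. -/
structure Tri where
  a : ℤ
  b : ℤ
  down : Bool
deriving DecidableEq

namespace Tri

/-- The barycentric coordinates of a point with respect to a lattice triangle. -/
noncomputable def bary (t : Tri) (z : ℂ) : Fin 3 → ℝ :=
  match t.down with
  | false => ![cv z - t.b, cu z - t.a, t.a + t.b + 1 - (cu z + cv z)]
  | true => ![t.b + 1 - cv z, t.a + 1 - cu z, cu z + cv z - (t.a + t.b + 1)]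

noncomputable def set (t : Tri) : Set ℂ := {z | ∀ j, 0 ≤ t.bary z j}

/-- The part of a triangle that is closest to one of its sides. -/
noncomputable def third (t : Tri) (i : Fin 3) : Set ℂ :=
  {z | 0 ≤ t.bary z i ∧ ∀ j, t.bary z i ≤ t.bary z j}

/-- Rotation about the origin by 60 degrees. -/
def rot (t : Tri) : Tri :=
  match t.down with
  | false => ⟨-t.b - 1, t.a + t.b, true⟩
  | true => ⟨-t.b - 1, t.a + t.b + 1, false⟩

/-- Reflection in the real axis. -/
def refl (t : Tri) : Tri :=
  match t.down with
  | false => ⟨t.a + t.b, -t.b - 1, true⟩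
  | true => ⟨t.a + t.b + 1, -t.b - 1, false⟩

def shift (x y : ℤ) (t : Tri) : Tri := ⟨t.a + x, t.b + y, t.down⟩

end Tri

theorem cu_rot (z : ℂ) : cu (zeta ^ 2 * z) = -cv z := by
  have h : √3 * √3 = (3 : ℝ) := Real.mul_self_sqrt (by norm_num)
  have h' : √3 ≠ 0 := by positivity
  simp only [zeta_pow_eq_toC, Cyc.rot, Cyc.rotOne, Cyc.toC, cu, cv, mul_re, mul_im]
  push_cast
  field_simp
  linear_combination (-3 * z.im) * h

theorem cv_rot (z : ℂ) : cv (zeta ^ 2 * z) = cu z + cv z := by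
  have h' : √3 ≠ 0 := by positivity
  simp only [zeta_pow_eq_toC, Cyc.rot, Cyc.rotOne, Cyc.toC, cu, cv, mul_im]
  push_cast
  field_simp
  ring

theorem cu_conj (z : ℂ) : cu (conj z) = cu z + cv z := by
  simp only [cu, cv, conj_re, conj_im]; ring

theorem cv_conj (z : ℂ) : cv (conj z) = -cv z := by
  simp only [cv, conj_im]; ring

theorem cu_real_mul (r : ℝ) (z : ℂ) : cu (r * z) = r * cu z := by
  simp only [cu, re_ofReal_mul, im_ofReal_mul]; ring

theorem cv_real_mul (r : ℝ) (z : ℂ) : cv (r * z) = r * cv z := by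
  simp only [cv, im_ofReal_mul]; ring

/-- The lattice point with coordinates `x`, `y`. -/
noncomputable def lat (x y : ℤ) : ℂ := x + y * zeta ^ 2

theorem cu_one : cu 1 = 1 := by simp [cu]

theorem cv_one : cv 1 = 0 := by simp [cv]

theorem cu_lat (x y : ℤ) : cu (lat x y) = x := by
  have h1 := cu_real_mul x 1
  have h2 := cu_real_mul y (zeta ^ 2 * 1)
  rw [cu_rot, cv_one] at h2
  rw [cu_one] at h1
  rw [lat, cu_add]
  push_cast at h1 h2
  rw [mul_one] at h1 h2
  rw [h1, h2]; ring

theorem cv_lat (x y : ℤ) : cv (lat x y) = y := by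
  have h1 := cv_real_mul x 1
  have h2 := cv_real_mul y (zeta ^ 2 * 1)
  rw [cv_rot, cv_one, cu_one] at h2
  rw [cv_one] at h1
  rw [lat, cv_add]
  push_cast at h1 h2
  rw [mul_one] at h1 h2
  rw [h1, h2]; ring

theorem cu_sub (z w : ℂ) : cu (z - w) = cu z - cu w := by simp only [cu, sub_re, sub_im]; ring

theorem cv_sub (z w : ℂ) : cv (z - w) = cv z - cv w := by simp only [cv, sub_im]; ring

theorem ext_cu_cv {z w : ℂ} (h1 : cu z = cu w) (h2 : cv z = cv w) : z = w := by
  apply Complex.ext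
  · rw [re_eq, re_eq w, h1, h2]
  · rw [im_eq, im_eq w, h2]

theorem zeta_sq_mul_lat (x y : ℤ) : zeta ^ 2 * lat x y = lat (-y) (x + y) := by
  apply ext_cu_cv <;> simp [cu_rot, cv_rot, cu_lat, cv_lat]

namespace Tri

/-- The coordinates are ordered so that rotation by 60° shifts the index cyclically, also when it
exchanges upward and downward triangles. The thirds then rotate by `side + 1`. -/
theorem bary_rot (t : Tri) (z : ℂ) (j : Fin 3) : t.rot.bary (zeta ^ 2 * z) (j + 1) = t.bary z j := by
  obtain ⟨a, b, d⟩ := t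
  cases d <;> fin_cases j <;> simp [bary, rot, cu_rot, cv_rot] <;> ring

theorem bary_shift (t : Tri) (x y : ℤ) (z : ℂ) : (t.shift x y).bary z = t.bary (z - lat x y) := by
  obtain ⟨a, b, d⟩ := t
  funext j
  cases d <;> fin_cases j <;> simp [bary, shift, cu_sub, cv_sub, cu_lat, cv_lat] <;> ring

theorem mem_rot {t : Tri} {z : ℂ} : zeta ^ 2 * z ∈ t.rot.set ↔ z ∈ t.set := by
  simp only [set, Set.mem_ofPred_eq, ← t.bary_rot z]
  exact ((Equiv.addRight (1 : Fin 3)).forall_congr_right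
    (q := fun j => 0 ≤ t.rot.bary (zeta ^ 2 * z) j)).symm

theorem mem_third_rot {t : Tri} {i : Fin 3} {z : ℂ} :
    zeta ^ 2 * z ∈ t.rot.third (i + 1) ↔ z ∈ t.third i := by
  simp only [third, Set.mem_ofPred_eq, ← t.bary_rot z]
  refine and_congr_right fun _ => ?_
  exact ((Equiv.addRight (1 : Fin 3)).forall_congr_right
    (q := fun j => t.rot.bary (zeta ^ 2 * z) (i + 1) ≤ t.rot.bary (zeta ^ 2 * z) j)).symm

theorem mem_refl {t : Tri} {z : ℂ} : conj z ∈ t.refl.set ↔ z ∈ t.set := by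
  obtain ⟨a, b, d⟩ := t
  cases d <;> simp [set, bary, refl, Fin.forall_fin_succ, cu_conj, cv_conj, -and_congr_right_iff] <;>
    constructor <;> rintro ⟨h1, h2, h3⟩ <;> refine ⟨?_, ?_, ?_⟩ <;> linarith

theorem mem_shift {t : Tri} {x y : ℤ} {z : ℂ} : z ∈ (t.shift x y).set ↔ z - lat x y ∈ t.set := by
  simp only [set, Set.mem_ofPred_eq, bary_shift]

theorem mem_third_shift {t : Tri} {x y : ℤ} {i : Fin 3} {z : ℂ} :
    z ∈ (t.shift x y).third i ↔ z - lat x y ∈ t.third i := by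
  simp only [third, Set.mem_ofPred_eq, bary_shift]

theorem mem_set_iff (t : Tri) (z : ℂ) : z ∈ t.set ↔ ∃ i, z ∈ t.third i := by
  constructor
  · intro h
    obtain ⟨i, hi⟩ := Finite.exists_min (t.bary z)
    exact ⟨i, h i, hi⟩
  · rintro ⟨i, h0, h⟩ j
    exact h0.trans (h j)

end Tri

/-- The pieces of a tile: a third of a lattice triangle, and two more triangles. -/
structure Pieces where
  top : Tri
  side : Fin 3
  mid : Tri
  low : Tri

namespace Pieces

noncomputable def set (P : Pieces) : Set ℂ := P.top.third P.side ∪ (P.mid.set ∪ P.low.set)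

/-- In the unreflected case `top` contains `ADE` as the third along `AD`, `mid` is `ABD` and `low`
is `BCD`; the other case is the mirror image. -/
def base : Bool → Pieces
  | false => ⟨⟨0, 0, false⟩, 0, ⟨0, -1, true⟩, ⟨1, -1, false⟩⟩
  | true => ⟨⟨0, -1, true⟩, 0, ⟨0, 0, false⟩, ⟨0, 0, true⟩⟩

def rot : ℕ → Pieces → Pieces
  | 0, P => P
  | k + 1, P => let Q := rot k P; ⟨Q.top.rot, Q.side + 1, Q.mid.rot, Q.low.rot⟩

def shift (x y : ℤ) (P : Pieces) : Pieces :=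
  ⟨P.top.shift x y, P.side, P.mid.shift x y, P.low.shift x y⟩

theorem mem_base (c : Bool) (z : ℂ) : z ∈ (base c).set ↔ z ∈ (polyC c).closed := by
  have h3 : 0 < √3 / 2 := by positivity
  have hn := fun x : ℝ => mul_nonneg_iff_of_pos_left (b := x) h3
  cases c
  · have e : z ∈ (polyC false).closed ↔ 0 ≤ cu z + cv z ∧ -1 ≤ cv z ∧ cu z + cv z ≤ 1 ∧
        cu z + 2 * cv z ≤ 1 ∧ cv z ≤ cu z := by
      simp only [polyC, Poly.closed, Set.mem_ofPred_eq, List.forall_mem_cons, List.not_mem_nil,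
        false_implies, implies_true, and_true, sd_even, sd_odd, cu_toC, cv_toC, hn]
      push_cast
      constructor <;> rintro ⟨h1, h2, h3, h4, h5⟩ <;> refine ⟨?_, ?_, ?_, ?_, ?_⟩ <;> linarith
    rw [e]
    simp [set, base, Tri.set, Tri.third, Tri.bary, Fin.forall_fin_succ]
    constructor
    · rintro (h | h | h) <;> obtain ⟨h1, h2, h3⟩ := h <;> refine ⟨?_, ?_, ?_, ?_, ?_⟩ <;> linarith
    · rintro ⟨h1, h2, h3, h4, h5⟩
      rcases le_total 0 (cv z) with h | h
      · left; refine ⟨?_, ?_, ?_⟩ <;> linarith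
      · right
        rcases le_total (cu z) 1 with h' | h'
        · left; refine ⟨?_, ?_, ?_⟩ <;> linarith
        · right; refine ⟨?_, ?_, ?_⟩ <;> linarith
  · have e : z ∈ (polyC true).closed ↔ 0 ≤ cu z ∧ cv z ≤ 1 ∧ cu z ≤ 1 ∧
        cu z - cv z ≤ 1 ∧ 0 ≤ cu z + 2 * cv z := by
      rw [mem_closed_true, re_eq, im_eq]
      have h : √3 * √3 = (3 : ℝ) := Real.mul_self_sqrt (by norm_num)
      have e1 : √3 * (cu z + cv z / 2) - √3 / 2 * cv z = √3 / 2 * (2 * cu z) := by ring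
      have e2 : -(√3 / 2 * cv z) + √3 / 2 = √3 / 2 * (1 - cv z) := by ring
      have e3 : √3 + √3 / 2 * cv z - √3 * (cu z + cv z / 2) = √3 / 2 * (2 - 2 * cu z) := by ring
      have e4 : √3 * (√3 / 2 * cv z) = 3 / 2 * cv z := by linear_combination (cv z / 2) * h
      rw [e1, e2, e3, e4, hn, hn, hn]
      constructor <;> rintro ⟨h1, h2, h3, h4, h5⟩ <;> refine ⟨?_, ?_, ?_, ?_, ?_⟩ <;> linarith
    rw [e]
    simp [set, base, Tri.set, Tri.third, Tri.bary, Fin.forall_fin_succ]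
    constructor
    · rintro (h | h | h) <;> obtain ⟨h1, h2, h3⟩ := h <;> refine ⟨?_, ?_, ?_, ?_, ?_⟩ <;> linarith
    · rintro ⟨h1, h2, h3, h4, h5⟩
      rcases le_total (cv z) 0 with h | h
      · left; refine ⟨?_, ?_, ?_⟩ <;> linarith
      · right
        rcases le_total (cu z + cv z) 1 with h' | h'
        · left; refine ⟨?_, ?_, ?_⟩ <;> linarith
        · right; refine ⟨?_, ?_, ?_⟩ <;> linarith

theorem mem_rot (k : ℕ) (P : Pieces) (z : ℂ) : zeta ^ (2 * k) * z ∈ (P.rot k).set ↔ z ∈ P.set := by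
  induction k with
  | zero => simp [rot]
  | succ k ih =>
    rw [← ih, show zeta ^ (2 * (k + 1)) * z = zeta ^ 2 * (zeta ^ (2 * k) * z) by ring]
    simp only [rot, set, Set.mem_union, Tri.mem_rot, Tri.mem_third_rot]

theorem mem_shift (P : Pieces) (x y : ℤ) (z : ℂ) : z ∈ (P.shift x y).set ↔ z - lat x y ∈ P.set := by
  simp only [shift, set, Set.mem_union, Tri.mem_shift, Tri.mem_third_shift]

end Pieces

/-- A tile whose vertices `A`, `B`, `C`, `D` are lattice points, `A` being `(x, y)`. -/
structure LatTile where
  x : ℤ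
  y : ℤ
  k : ℕ
  flip : Bool

namespace LatTile

noncomputable def set (t : LatTile) : Set ℂ := tileSet (zeta ^ (2 * t.k)) (lat t.x t.y) t.flip

def pieces (t : LatTile) : Pieces := ((Pieces.base t.flip).rot t.k).shift t.x t.y

theorem set_eq (t : LatTile) : t.set = t.pieces.set := by
  ext z
  have h := conj_mul_self_of_norm (norm_zeta_pow (2 * t.k))
  rw [set, mem_tileSet (norm_zeta_pow _), pieces, Pieces.mem_shift, ← Pieces.mem_base,
    ← Pieces.mem_rot t.k, ← mul_assoc, mul_comm (zeta ^ _), h, one_mul]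

/-- Rotation about the origin by 60 degrees. -/
def rot (t : LatTile) : LatTile := ⟨-t.y, t.x + t.y, t.k + 1, t.flip⟩

theorem mem_rot {t : LatTile} {z : ℂ} : zeta ^ 2 * z ∈ t.rot.set ↔ z ∈ t.set := by
  have h : conj zeta * zeta = 1 := conj_zeta_mul
  rw [set, set, mem_tileSet (norm_zeta_pow _), mem_tileSet (norm_zeta_pow _), rot,
    ← zeta_sq_mul_lat]
  simp only [map_pow]
  rw [show conj zeta ^ (2 * (t.k + 1)) * (zeta ^ 2 * z - zeta ^ 2 * lat t.x t.y)
    = (conj zeta * zeta) ^ 2 * (conj zeta ^ (2 * t.k) * (z - lat t.x t.y)) by ring, h]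
  simp

end LatTile

/-- The point lies on none of the lines carrying sides or axes of symmetry of lattice triangles. -/
def Generic (z : ℂ) : Prop :=
  ∀ p ∈ [((1 : ℤ), (0 : ℤ)), (0, 1), (1, 1), (1, -1), (2, 1), (1, 2)], ∀ n : ℤ,
    p.1 * cu z + p.2 * cv z ≠ n

/-- A line in direction `lat 1 2` is parallel to none of the six families, since `p.1 + 2 * p.2 ≠ 0`
for each; it meets them in a countable set. -/
theorem exists_generic {U : Set ℂ} (hU : IsOpen U) (hne : U.Nonempty) : ∃ z ∈ U, Generic z := by
  obtain ⟨z, hz⟩ := hne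
  let L : List (ℤ × ℤ) := [(1, 0), (0, 1), (1, 1), (1, -1), (2, 1), (1, 2)]
  let bad : Set ℝ := ⋃ p ∈ {p | p ∈ L}, Set.range fun n : ℤ =>
    (n - (p.1 * cu z + p.2 * cv z)) / (p.1 + 2 * p.2 : ℝ)
  have hbad : bad.Countable :=
    (List.finite_toSet L).countable.biUnion fun p _ => Set.countable_range _
  obtain ⟨t, ht, htU⟩ := (hbad.dense_compl ℝ).exists_mem_open
    (hU.preimage (show Continuous fun t : ℝ => z + t * lat 1 2 by fun_prop)) ⟨0, by simpa using hz⟩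
  refine ⟨_, htU, fun p hp n h => ht ?_⟩
  rw [cu_add, cv_add, cu_real_mul, cv_real_mul, cu_lat, cv_lat] at h
  have h0 : (p.1 + 2 * p.2 : ℝ) ≠ 0 := by
    have : ∀ p ∈ L, p.1 + 2 * p.2 ≠ 0 := by decide
    exact_mod_cast this p hp
  refine Set.mem_biUnion hp ⟨n, ?_⟩
  push_cast at h
  simp only
  rw [div_eq_iff h0]
  linarith

/-- The floors of the two coordinates give the cell, and comparing `cu + cv` with `a + b + 1` gives
the half. -/
theorem Generic.tri_eq {z : ℂ} (hz : Generic z) {t t' : Tri} (h : z ∈ t.set) (h' : z ∈ t'.set) :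
    t = t' := by
  have key : ∀ t : Tri, z ∈ t.set → ⌊cu z⌋ = t.a ∧ ⌊cv z⌋ = t.b ∧
      (t.down = true ↔ t.a + t.b + 1 < cu z + cv z) := by
    rintro ⟨a, b, d⟩ h
    have h1 := hz (1, 0) (by simp)
    have h2 := hz (0, 1) (by simp)
    have h3 := hz (1, 1) (by simp) (a + b + 1)
    simp only [Int.cast_one, Int.cast_zero, one_mul, zero_mul, zero_add, add_zero] at h1 h2 h3
    push_cast at h3
    have ha := h1 a
    have ha1 := h1 (a + 1)
    have hb := h2 b
    have hb1 := h2 (b + 1)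
    push_cast at ha1 hb1
    cases d
    · simp [Tri.set, Tri.bary, Fin.forall_fin_succ] at h
      obtain ⟨e1, e2, e3⟩ := h
      have e1 := lt_of_le_of_ne e1 hb.symm
      have e2 := lt_of_le_of_ne e2 ha.symm
      have e3 := lt_of_le_of_ne e3 h3
      refine ⟨Int.floor_eq_iff.mpr ⟨?_, ?_⟩, Int.floor_eq_iff.mpr ⟨?_, ?_⟩, ?_⟩ <;>
        [skip; skip; skip; skip; simp only [Bool.false_eq_true, false_iff, not_lt]] <;>
        linarith
    · simp [Tri.set, Tri.bary, Fin.forall_fin_succ] at h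
      obtain ⟨e1, e2, e3⟩ := h
      have e1 := lt_of_le_of_ne e1 hb1
      have e2 := lt_of_le_of_ne e2 ha1
      have e3 := lt_of_le_of_ne e3 h3.symm
      refine ⟨Int.floor_eq_iff.mpr ⟨?_, ?_⟩, Int.floor_eq_iff.mpr ⟨?_, ?_⟩, ?_⟩ <;>
        [skip; skip; skip; skip; simp only [true_iff]] <;>
        linarith
  obtain ⟨a, b, d⟩ := t
  obtain ⟨a', b', d'⟩ := t'
  obtain ⟨h1, h2, h3⟩ := key _ h
  obtain ⟨h1', h2', h3'⟩ := key _ h'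
  simp only at h1 h2 h3 h1' h2' h3'
  have e1 : a = a' := h1.symm.trans h1'
  have e2 : b = b' := h2.symm.trans h2'
  subst e1 e2
  rw [← h3', Bool.eq_iff_iff.symm] at h3
  rw [h3]

/-- Two equal barycentric coordinates would put the point on an axis of symmetry, where `cu - cv`,
`2 cu + cv` or `cu + 2 cv` is an integer. -/
theorem Generic.third_eq {z : ℂ} (hz : Generic z) {t t' : Tri} {i i' : Fin 3} (h : z ∈ t.third i)
    (h' : z ∈ t'.third i') : (t, i) = (t', i') := by
  have e := hz.tri_eq ((t.mem_set_iff z).mpr ⟨i, h⟩) ((t'.mem_set_iff z).mpr ⟨i', h'⟩)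
  subst e
  by_contra hne
  have hi : i ≠ i' := fun e => hne (by rw [e])
  have heq : t.bary z i = t.bary z i' := le_antisymm (h.2 i') (h'.2 i)
  obtain ⟨a, b, d⟩ := t
  have h1 := fun n : ℤ => hz (1, -1) (by simp) n
  have h2 := fun n : ℤ => hz (2, 1) (by simp) n
  have h3 := fun n : ℤ => hz (1, 2) (by simp) n
  have h1 := h1 (a - b)
  have h2 := h2 (2 * a + b + 1)
  have h3 := h3 (a + 2 * b + 1)
  have h2' := fun n : ℤ => hz (2, 1) (by simp) n
  have h3' := fun n : ℤ => hz (1, 2) (by simp) n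
  have h2' := h2' (2 * a + b + 2)
  have h3' := h3' (a + 2 * b + 2)
  push_cast at h1 h2 h3 h2' h3'
  cases d <;> fin_cases i <;> fin_cases i' <;> simp [Tri.bary] at hi heq <;>
    first
    | exact h1 (by linarith)
    | exact h2 (by linarith)
    | exact h3 (by linarith)
    | exact h2' (by linarith)
    | exact h3' (by linarith)

/-- The thirds of triangles that make up a tile. -/
def Pieces.thirds (P : Pieces) : List (Tri × Fin 3) :=
  [(P.top, P.side), (P.mid, 0), (P.mid, 1), (P.mid, 2), (P.low, 0), (P.low, 1), (P.low, 2)]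

theorem Pieces.mem_set_iff (P : Pieces) (z : ℂ) :
    z ∈ P.set ↔ ∃ q ∈ P.thirds, z ∈ q.1.third q.2 := by
  simp only [set, Set.mem_union, Tri.mem_set_iff, thirds, Fin.exists_fin_succ]
  simp [or_assoc]

/-- The union of a list of triangles. -/
def region (L : List Tri) : Set ℂ := {z | ∃ t ∈ L, z ∈ t.set}

def allThirds (Ts : List LatTile) : List (Tri × Fin 3) := Ts.flatMap fun t => t.pieces.thirds

/-- The tiles and the triangles have the same union. -/
def covers (Ts : List LatTile) (L : List Tri) : Bool :=
  (Ts.all fun t => L.contains t.pieces.top && (L.contains t.pieces.mid && L.contains t.pieces.low))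
    && (L.all fun T => Ts.any (fun t => t.pieces.mid = T || t.pieces.low = T) ||
      (List.finRange 3).all fun i => Ts.any fun t => t.pieces.top = T && t.pieces.side = i)

theorem covers_sound {Ts : List LatTile} {L : List Tri} (h : covers Ts L = true) (z : ℂ) :
    (∃ t ∈ Ts, z ∈ t.set) ↔ z ∈ region L := by
  simp only [covers, Bool.and_eq_true, List.all_eq_true, List.contains_iff_mem, Bool.or_eq_true,
    List.any_eq_true, decide_eq_true_eq] at h
  obtain ⟨h1, h2⟩ := h
  constructor
  · rintro ⟨t, ht, hz⟩
    obtain ⟨e1, e2, e3⟩ := h1 t ht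
    rw [LatTile.set_eq] at hz
    rcases hz with hz | hz | hz
    · exact ⟨_, e1, (Tri.mem_set_iff _ _).mpr ⟨_, hz⟩⟩
    · exact ⟨_, e2, hz⟩
    · exact ⟨_, e3, hz⟩
  · rintro ⟨T, hT, hz⟩
    rcases h2 T hT with ⟨t, ht, rfl | rfl⟩ | h3
    · exact ⟨t, ht, by rw [LatTile.set_eq]; exact Or.inr (Or.inl hz)⟩
    · exact ⟨t, ht, by rw [LatTile.set_eq]; exact Or.inr (Or.inr hz)⟩
    · obtain ⟨i, hi⟩ := (Tri.mem_set_iff _ _).mp hz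
      obtain ⟨t, ht, rfl, rfl⟩ := h3 i (List.mem_finRange i)
      exact ⟨t, ht, by rw [LatTile.set_eq]; exact Or.inl hi⟩

/-- If two interiors met, their open intersection would contain a generic point. It lies in exactly
one third, which would then occur in both tiles. -/
theorem disjoint_interior_of_nodup {Ts : List LatTile} (h : (allThirds Ts).Nodup) :
    Ts.Pairwise fun t t' => Disjoint (interior t.set) (interior t'.set) := by
  refine (List.nodup_flatMap.mp h).2.imp fun {t t'} hd => ?_
  rw [Set.disjoint_iff_inter_eq_empty, ← Set.not_nonempty_iff_eq_empty]
  intro hne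
  obtain ⟨z, hz, hg⟩ := exists_generic (isOpen_interior.inter isOpen_interior) hne
  have h1 := interior_subset hz.1
  have h2 := interior_subset hz.2
  rw [LatTile.set_eq, Pieces.mem_set_iff] at h1 h2
  obtain ⟨⟨q, i⟩, hq, hzq⟩ := h1
  obtain ⟨⟨q', i'⟩, hq', hzq'⟩ := h2
  have := hg.third_eq hzq hzq'
  rw [← this] at hq'
  exact hd hq hq'

/-- Counting replaces comparing pairs of tiles. The thirds of the triangles are distinct and all
occur among the seven thirds of each tile; as the totals agree, the second list is a permutation of
the first. -/
theorem nodup_of_covers {Ts : List LatTile} {L : List Tri} (hc : covers Ts L = true)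
    (hL : L.Nodup) (hl : 7 * Ts.length = 3 * L.length) : (allThirds Ts).Nodup := by
  have hn : (L ×ˢ List.finRange 3).Nodup := hL.product (List.nodup_finRange 3)
  have hs : L ×ˢ List.finRange 3 ⊆ allThirds Ts := by
    simp only [covers, Bool.and_eq_true, List.all_eq_true, Bool.or_eq_true, List.any_eq_true,
      decide_eq_true_eq] at hc
    rintro ⟨T, i⟩ h
    have h := List.pair_mem_product.mp h
    rw [allThirds, List.mem_flatMap]
    rcases hc.2 T h.1 with ⟨t, ht, rfl | rfl⟩ | h3
    · exact ⟨t, ht, by fin_cases i <;> simp [Pieces.thirds]⟩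
    · exact ⟨t, ht, by fin_cases i <;> simp [Pieces.thirds]⟩
    · obtain ⟨t, ht, rfl, rfl⟩ := h3 i (List.mem_finRange i)
      exact ⟨t, ht, by simp [Pieces.thirds]⟩
  have e1 : (allThirds Ts).length = 7 * Ts.length := by
    simp [allThirds, List.length_flatMap, Pieces.thirds, mul_comm]
  have e2 : (L ×ˢ List.finRange 3).length = 3 * L.length := by
    rw [List.length_product, List.length_finRange, mul_comm]
  exact ((hn.subperm hs).perm_of_length_le (by omega)).nodup_iff.mp hn

theorem isTiling_of_covers {Ts : List LatTile} {L : List Tri} (hc : covers Ts L = true)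
    (hL : L.Nodup) (hl : 7 * Ts.length = 3 * L.length) :
    IsTiling (fun i : Fin Ts.length => Ts[i].set) (region L) where
  tile i := ⟨_, _, _, norm_zeta_pow _, rfl⟩
  disj i j hij := by
    have hp := List.pairwise_iff_getElem.mp (disjoint_interior_of_nodup (nodup_of_covers hc hL hl))
    rcases lt_or_gt_of_ne (Fin.val_ne_of_ne hij) with h | h
    · exact hp _ _ _ _ h
    · exact (hp _ _ j.2 i.2 h).symm
  cover := by
    ext z
    rw [← covers_sound hc, Set.mem_iUnion]
    constructor
    · rintro ⟨i, hi⟩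
      exact ⟨_, List.getElem_mem _, hi⟩
    · rintro ⟨t, ht, hz⟩
      obtain ⟨i, hi, rfl⟩ := List.getElem_of_mem ht
      exact ⟨⟨i, hi⟩, hz⟩

/-! ### The flower as a union of triangles, and the explicit tilings -/

/-- The triangles of the windmill unit, with the vertex `C` as origin. -/
def windmillTris : List Tri :=
  [⟨0, 0, false⟩, ⟨0, -1, true⟩, ⟨1, -1, false⟩, ⟨0, 0, true⟩, ⟨0, 1, false⟩, ⟨-1, 0, true⟩,
    ⟨-1, 0, false⟩].map (Tri.shift (-2) 1)

def sixfold {α : Type*} (r : α → α) (L : List α) : List α :=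
  (List.range 6).flatMap fun k => L.map r^[k]

/-- The triangles of the flower of side length one with centre at the origin. -/
def flowerTris : List Tri := sixfold Tri.rot windmillTris

/-- The subdivision of a triangle into `s ^ 2` triangles, scaled by `s`. -/
def Tri.sub (s : ℕ) (t : Tri) : List Tri :=
  (List.range s).flatMap fun i => (List.range s).flatMap fun j =>
    match t.down with
    | false => (if i + j + 1 ≤ s then [⟨s * t.a + i, s * t.b + j, false⟩] else []) ++
        if i + j + 2 ≤ s then [⟨s * t.a + i, s * t.b + j, true⟩] else []
    | true => (if s ≤ i + j + 1 then [⟨s * t.a + i, s * t.b + j, true⟩] else []) ++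
        if s ≤ i + j then [⟨s * t.a + i, s * t.b + j, false⟩] else []

def scaledTris (s : ℕ) : List Tri := flowerTris.flatMap (Tri.sub s)

/-- One sixth of a tiling; the other tiles are its rotations about the centre. For side `s` the
sixth has `3 s²` tiles, that is 3, 12 and 27. -/
def tilesOne : List LatTile := [⟨-1, 0, 3, true⟩, ⟨-2, 0, 1, true⟩, ⟨-2, 1, 5, true⟩]

def tilesTwo : List LatTile := [⟨-1, 0, 3, false⟩, ⟨-1, -1, 1, false⟩, ⟨-2, 0, 5, false⟩,
  ⟨-6, 3, 0, true⟩, ⟨-5, 3, 4, true⟩, ⟨-6, 3, 5, false⟩, ⟨-3, 0, 3, true⟩, ⟨-4, 0, 1, true⟩,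
  ⟨-4, 1, 5, true⟩, ⟨-3, 2, 3, true⟩, ⟨-4, 2, 1, true⟩, ⟨-4, 3, 5, true⟩]

def tilesThree : List LatTile := [⟨-1, 0, 3, true⟩, ⟨-2, 0, 1, true⟩, ⟨-2, 1, 5, true⟩,
  ⟨-9, 5, 0, true⟩, ⟨-8, 4, 1, false⟩, ⟨-9, 5, 5, false⟩, ⟨-8, 2, 0, false⟩, ⟨-8, 2, 1, true⟩,
  ⟨-7, 2, 2, false⟩, ⟨-6, 5, 3, true⟩, ⟨-7, 6, 4, false⟩, ⟨-7, 6, 5, true⟩, ⟨-6, 3, 3, false⟩,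
  ⟨-6, 2, 1, false⟩, ⟨-7, 3, 5, false⟩, ⟨-6, 1, 0, true⟩, ⟨-5, 1, 4, true⟩, ⟨-5, 0, 2, true⟩,
  ⟨-6, 4, 0, true⟩, ⟨-5, 3, 1, false⟩, ⟨-5, 3, 2, true⟩, ⟨-5, 2, 0, true⟩, ⟨-4, 2, 4, true⟩,
  ⟨-5, 2, 5, false⟩, ⟨-3, -1, 0, false⟩, ⟨-3, -1, 1, true⟩, ⟨-2, -1, 2, false⟩]

theorem covers_one : covers (sixfold LatTile.rot tilesOne) (scaledTris 1) = true := by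
  decide +kernel

theorem covers_two : covers (sixfold LatTile.rot tilesTwo) (scaledTris 2) = true := by
  decide +kernel

theorem covers_three : covers (sixfold LatTile.rot tilesThree) (scaledTris 3) = true := by
  decide +kernel

theorem nodup_scaledTris_one : (scaledTris 1).Nodup := by decide +kernel

theorem nodup_scaledTris_two : (scaledTris 2).Nodup := by decide +kernel

theorem nodup_scaledTris_three : (scaledTris 3).Nodup := by decide +kernel

theorem region_rot {z : ℂ} (h : z ∈ region flowerTris) : zeta ^ 2 * z ∈ region flowerTris := by
  have hd : ∀ t ∈ flowerTris, t.rot ∈ flowerTris := by decide +kernel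
  obtain ⟨t, ht, hz⟩ := h
  exact ⟨_, hd t ht, Tri.mem_rot.mpr hz⟩

theorem region_refl {z : ℂ} (h : z ∈ region flowerTris) : conj z ∈ region flowerTris := by
  have hd : ∀ t ∈ flowerTris, t.refl ∈ flowerTris := by decide +kernel
  obtain ⟨t, ht, hz⟩ := h
  exact ⟨_, hd t ht, Tri.mem_refl.mpr hz⟩

theorem region_rot_pow {z : ℂ} (h : z ∈ region flowerTris) (k : ℕ) :
    zeta ^ (2 * k) * z ∈ region flowerTris := by
  induction k with
  | zero => simpa
  | succ k ih =>
    rw [show zeta ^ (2 * (k + 1)) * z = zeta ^ 2 * (zeta ^ (2 * k) * z) by ring]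
    exact region_rot ih

theorem exp_eq_zeta_pow (m : ℕ) {θ : ℝ} (h : θ = m * (Real.pi / 6)) :
    Complex.exp (θ * I) = zeta ^ m := by
  have : zeta = Complex.exp ((Real.pi / 6 : ℝ) * I) := by
    rw [exp_mul_I, ← ofReal_cos, ← ofReal_sin, Real.cos_pi_div_six, Real.sin_pi_div_six]
    apply Complex.ext <;> simp [zeta]
  rw [this, ← Complex.exp_nat_mul, h]
  congr 1
  push_cast
  ring

/-- The tiles of the windmill unit, with the vertex `C` as origin. -/
def windmillTiles : List LatTile := [⟨-2, 1, 0, false⟩, ⟨-1, 1, 2, false⟩, ⟨-2, 2, 4, false⟩]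

theorem vC_eq : vC = lat 2 (-1) := by
  apply ext_cu_cv
  · have h : √3 ≠ 0 := by positivity
    rw [cu_lat]; simp only [cu, vC]; field_simp; norm_num
  · have h : √3 ≠ 0 := by positivity
    rw [cv_lat]; simp only [cv, vC]; field_simp; norm_num

theorem vE_eq : vE = (1 + zeta ^ 2) / 3 := by
  rw [zeta_pow_eq_toC]
  apply Complex.ext <;> simp [vE, Cyc.rot, Cyc.rotOne, Cyc.toC] <;> ring

/-- The rotation about `E` through `120 k` degrees sends `A = 0` to `E - ζ ^ (4k) E`. Relative to
`C` this is a lattice point, although `E` itself is not. -/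
theorem mem_windmillUnit (z : ℂ) : z ∈ windmillUnit ↔ ∃ t ∈ windmillTiles, z - vC ∈ t.set := by
  have hz4 : zeta ^ 4 = zeta ^ 2 - 1 := by
    simp only [zeta_pow_eq_toC]
    apply Complex.ext <;> simp [Cyc.rot, Cyc.rotOne, Cyc.toC] <;> ring
  have key : ∀ (k : ℕ) (x y : ℤ), vE - zeta ^ (4 * k) * vE - vC = lat x y →
      (z ∈ rotateAbout vE ((k : ℝ) * (2 * Real.pi / 3)) '' thPentagon ↔
        z - vC ∈ (⟨x, y, 2 * k, false⟩ : LatTile).set) := by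
    intro k x y h
    have e := exp_eq_zeta_pow (4 * k) (θ := (k : ℝ) * (2 * Real.pi / 3)) (by push_cast; ring)
    simp only [LatTile.set, tileSet, model, Set.mem_image, rotateAbout, e, ← h]
    refine exists_congr fun w => and_congr_right fun _ => ?_
    rw [show 2 * (2 * k) = 4 * k by ring]
    constructor <;> intro h' <;> linear_combination h'
  have h0 := key 0 (-2) 1 (by rw [vC_eq]; simp only [lat]; push_cast; ring)
  have h1 := key 1 (-1) 1 (by
    rw [vC_eq, vE_eq]; simp only [lat, mul_one]; push_cast
    linear_combination (-(1 + zeta ^ 2) / 3 - 1 / 3) * hz4)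
  have h2 := key 2 (-2) 2 (by
    rw [vC_eq, vE_eq]; simp only [lat]; push_cast
    linear_combination
      (-(1 + zeta ^ 2) / 3 * (zeta ^ 4 + zeta ^ 2 - 1) - (zeta ^ 2 - 2) / 3 - 2 / 3) * hz4)
  rw [windmillUnit, Set.mem_iUnion, Fin.exists_fin_succ, Fin.exists_fin_succ, Fin.exists_fin_succ]
  simp only [windmillTiles, List.mem_cons, List.not_mem_nil, or_false, exists_eq_or_imp,
    exists_eq_left]
  refine or_congr h0 (or_congr h1 ?_)
  rw [← h2]
  simp only [IsEmpty.exists_iff, or_false]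
  rfl

theorem LatTile.mem_rot_iterate {t : LatTile} {z : ℂ} (k : ℕ) :
    zeta ^ (2 * k) * z ∈ (LatTile.rot^[k] t).set ↔ z ∈ t.set := by
  induction k with
  | zero => simp
  | succ k ih =>
    rw [← ih, Function.iterate_succ_apply', ← LatTile.mem_rot (t := LatTile.rot^[k] t)]
    rw [show zeta ^ (2 * (k + 1)) * z = zeta ^ 2 * (zeta ^ (2 * k) * z) by ring]

theorem mem_hfl1Unit (z : ℂ) : z ∈ hfl1Unit ↔ z - vC ∈ region flowerTris := by
  have hc : covers (sixfold LatTile.rot windmillTiles) flowerTris = true := by decide +kernel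
  rw [← covers_sound hc]
  simp only [hfl1Unit, Set.mem_iUnion, Set.mem_image, sixfold, List.mem_flatMap, List.mem_range,
    List.mem_map, mem_windmillUnit]
  have e : ∀ k : ℕ, Complex.exp (((k : ℝ) * (Real.pi / 3) : ℝ) * I) = zeta ^ (2 * k) := fun k =>
    exp_eq_zeta_pow (2 * k) (by push_cast; ring)
  simp only [rotateAbout, e]
  constructor
  · rintro ⟨k, w, ⟨t, ht, hw⟩, rfl⟩
    refine ⟨_, ⟨k, k.2, t, ht, rfl⟩, ?_⟩
    rw [add_sub_cancel_left]
    exact (LatTile.mem_rot_iterate _).mpr hw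
  · rintro ⟨_, ⟨k, hk, t, ht, rfl⟩, hz⟩
    have h := conj_mul_self_of_norm (norm_zeta_pow (2 * k))
    have e1 : z - vC = zeta ^ (2 * k) * (conj (zeta ^ (2 * k)) * (z - vC)) := by
      linear_combination (-(z - vC)) * h
    rw [e1, LatTile.mem_rot_iterate] at hz
    refine ⟨⟨k, hk⟩, vC + conj (zeta ^ (2 * k)) * (z - vC), ⟨t, ht, ?_⟩, ?_⟩
    · rwa [add_sub_cancel_left]
    · rw [add_sub_cancel_left, ← e1]; ring

theorem Tri.coords {t : Tri} {z : ℂ} (h : z ∈ t.set) :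
    t.b ≤ cv z ∧ t.a + t.b + (if t.down then 1 else 0 : ℤ) ≤ cu z + cv z := by
  obtain ⟨a, b, d⟩ := t
  cases d <;> simp [set, bary, Fin.forall_fin_succ] at h ⊢ <;> obtain ⟨h1, h2, h3⟩ := h <;>
    constructor <;> linarith

theorem flower_below {z : ℂ} (h : z ∈ region flowerTris) : -3 ≤ cv z := by
  have hd : ∀ t ∈ flowerTris, -3 ≤ t.b := by decide +kernel
  obtain ⟨t, ht, hz⟩ := h
  have : (-3 : ℝ) ≤ t.b := by exact_mod_cast hd t ht
  linarith [(Tri.coords hz).1]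

theorem flower_left {z : ℂ} (h : z ∈ region flowerTris) (hz : cv z < -2) : -2 ≤ cu z + cv z := by
  have hd : ∀ t ∈ flowerTris, -2 ≤ t.b ∨ -2 ≤ t.a + t.b + (if t.down then 1 else 0 : ℤ) := by
    decide +kernel
  obtain ⟨t, ht, hzt⟩ := h
  have hc := Tri.coords hzt
  rcases hd t ht with h1 | h1
  · have : (-2 : ℝ) ≤ t.b := by exact_mod_cast h1
    linarith
  · have : (-2 : ℝ) ≤ t.a + t.b + (if t.down then 1 else 0 : ℤ) := by exact_mod_cast h1
    linarith

/-- These are the six triangles around the lattice point `(1, -2)`, the centre of an outer hexagon.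
-/
theorem flower_hexagon {z : ℂ} (h1 : -3 ≤ cv z) (h2 : cv z ≤ -1) (h3 : cu z ≤ 2) (h4 : 0 ≤ cu z)
    (h5 : -2 ≤ cu z + cv z) (h6 : cu z + cv z ≤ 0) : z ∈ region flowerTris := by
  have mem : ∀ t ∈ ([⟨1, -2, false⟩, ⟨0, -2, true⟩, ⟨0, -2, false⟩, ⟨0, -3, true⟩, ⟨1, -3, false⟩,
      ⟨1, -3, true⟩] : List Tri), t ∈ flowerTris := by decide +kernel
  have key : ∃ t ∈ ([⟨1, -2, false⟩, ⟨0, -2, true⟩, ⟨0, -2, false⟩, ⟨0, -3, true⟩, ⟨1, -3, false⟩,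
      ⟨1, -3, true⟩] : List Tri), z ∈ t.set := by
    simp [Tri.set, Tri.bary, Fin.forall_fin_succ]
    rcases le_total (cv z) (-2) with a | a <;> rcases le_total (cu z) 1 with b | b <;>
      rcases le_total (cu z + cv z) (-1) with c | c <;>
      first
      | (left; refine ⟨?_, ?_, ?_⟩ <;> linarith)
      | (right; left; refine ⟨?_, ?_, ?_⟩ <;> linarith)
      | (right; right; left; refine ⟨?_, ?_, ?_⟩ <;> linarith)
      | (right; right; right; left; refine ⟨?_, ?_, ?_⟩ <;> linarith)
      | (right; right; right; right; left; refine ⟨?_, ?_, ?_⟩ <;> linarith)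
      | (right; right; right; right; right; refine ⟨?_, ?_, ?_⟩ <;> linarith)
  obtain ⟨t, ht, hz⟩ := key
  exact ⟨t, mem t ht, hz⟩

/-- The flower of side length `s` in the position of `FlowerRegion`. -/
def flower (s : ℝ) : Set ℂ := {z | ((s⁻¹ : ℝ) : ℂ) * z - lat (-1) 3 ∈ region flowerTris}

/-- The shift by `lat (-1) 3` moves the corner `(1, -3)` of the centred flower to 0. The two
reflections are complex conjugation about the centre followed by rotations through 180° and 120°. -/
theorem flowerRegion_flower {s : ℝ} (hs : 0 < s) : FlowerRegion s (flower s) := by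
  have hi : 0 < s⁻¹ := inv_pos.mpr hs
  have hsi : s⁻¹ * s = 1 := inv_mul_cancel₀ hs.ne'
  have eu : ∀ z, cu (((s⁻¹ : ℝ) : ℂ) * z - lat (-1) 3) = s⁻¹ * cu z + 1 := fun z => by
    rw [cu_sub, cu_real_mul, cu_lat]; push_cast; ring
  have ev : ∀ z, cv (((s⁻¹ : ℝ) : ℂ) * z - lat (-1) 3) = s⁻¹ * cv z - 3 := fun z => by
    rw [cv_sub, cv_real_mul, cv_lat]; push_cast; ring
  have hsc : ((s⁻¹ : ℝ) : ℂ) * s = 1 := by exact_mod_cast hsi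
  have hconj : conj (lat (-1) 3) = lat 2 (-3) := by
    apply ext_cu_cv <;> simp [cu_conj, cv_conj, cu_lat, cv_lat]
    norm_num
  refine ⟨?_, ?_, ?_, ?_, ?_⟩
  · intro z h1 h2 h3 h4 h5 h6
    have h1 := mul_le_mul_of_nonneg_left h1 hi.le
    have h2 := mul_le_mul_of_nonneg_left h2 hi.le
    have h3 := mul_le_mul_of_nonneg_left h3 hi.le
    have h4 := mul_le_mul_of_nonneg_left h4 hi.le
    have h5 := mul_le_mul_of_nonneg_left h5 hi.le
    have h6 := mul_le_mul_of_nonneg_left h6 hi.le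
    apply flower_hexagon <;> (try rw [eu]) <;> (try rw [ev]) <;> nlinarith
  · intro z hz
    have := flower_below hz
    rw [ev] at this
    exact nonneg_of_mul_nonneg_right (by linarith : 0 ≤ s⁻¹ * cv z) hi
  · intro z hz h
    have h := mul_lt_mul_of_pos_left h hi
    have := flower_left hz (by rw [ev]; linarith)
    rw [eu, ev] at this
    exact nonneg_of_mul_nonneg_right (by linarith : 0 ≤ s⁻¹ * (cu z + cv z)) hi
  · intro z hz
    have := region_rot_pow (region_refl hz) 3
    have e : zeta ^ (2 * 3) = -1 := by
      rw [show zeta ^ (2 * 3) = (zeta ^ 3) ^ 2 by ring, zeta_cubed, I_sq]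
    rw [e, map_sub, map_mul, hconj, conj_ofReal] at this
    change ((s⁻¹ : ℝ) : ℂ) * (s - conj z) - lat (-1) 3 ∈ region flowerTris
    have e2 : lat 2 (-3) = 1 - lat (-1) 3 := by simp only [lat]; push_cast; ring
    rw [e2] at this
    convert this using 1
    linear_combination hsc
  · intro z hz
    have := region_rot_pow (region_refl hz) 2
    rw [map_sub, map_mul, hconj, conj_ofReal] at this
    change ((s⁻¹ : ℝ) : ℂ) * (s * zeta ^ 4 + zeta ^ 4 * conj (z - s * zeta ^ 4)) - lat (-1) 3
      ∈ region flowerTris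
    convert this using 1
    have h4 := conj_mul_self_of_norm (norm_zeta_pow 4)
    have e2 : zeta ^ 4 * (1 + lat 2 (-3)) = 1 + lat (-1) 3 := by
      have e3 : 1 + lat 2 (-3) = lat 3 (-3) := by simp only [lat]; push_cast; ring
      rw [e3, show zeta ^ 4 * lat 3 (-3) = zeta ^ 2 * (zeta ^ 2 * lat 3 (-3)) by ring,
        zeta_sq_mul_lat, zeta_sq_mul_lat]
      simp only [lat]; push_cast; ring
    rw [map_sub, map_mul, conj_ofReal]
    linear_combination (zeta ^ 4 - zeta ^ 4 * conj (zeta ^ 4)) * hsc - h4 + e2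

/-! ### Reduction of arbitrary flowers to standard ones, and subdivision -/

theorem exists_isometryEquiv {f : ℂ → ℂ} (hf : Isometry f) : ∃ e : ℂ ≃ᵢ ℂ, ∀ z, e z = f z :=
  ⟨(hf.affineIsometryOfStrictConvexSpace.toAffineIsometryEquiv rfl).toIsometryEquiv, fun _ => rfl⟩

theorem isometry_tile_map {a : ℂ} (ha : ‖a‖ = 1) (b : ℂ) : Isometry fun z => a * z + b := by
  apply Isometry.of_dist_eq
  intro x y
  rw [dist_add_right, dist_eq_norm, ← mul_sub, norm_mul, ha, one_mul, ← dist_eq_norm]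

theorem exists_image_eq_tileSet {a : ℂ} (ha : ‖a‖ = 1) (b : ℂ) (c : Bool) :
    ∃ e : ℂ ≃ᵢ ℂ, e '' thPentagon = tileSet a b c := by
  obtain ⟨e, he⟩ := exists_isometryEquiv (isometry_tile_map ha b)
  cases c
  · refine ⟨e, ?_⟩
    rw [tileSet, model]
    exact congrArg (· '' thPentagon) (funext he)
  · refine ⟨conjLIE.toIsometryEquiv.trans e, ?_⟩
    rw [tileSet, model, Set.image_image]
    refine congrArg (· '' thPentagon) (funext fun z => ?_)
    simp [he]

theorem filledByTHPentagons_iff (X : Set ℂ) :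
    FilledByTHPentagons X ↔ ∃ (n : ℕ) (T : Fin n → Set ℂ), IsTiling T X := by
  constructor
  · rintro ⟨n, f, hd, hc⟩
    refine ⟨n, fun i => f i '' thPentagon, fun i => ?_, hd, hc⟩
    have : thPentagon = tileSet 1 0 false := by simp [tileSet, model]
    obtain ⟨a, b, c, ha, h⟩ := exists_tileSet_image (f i).isometry (a := 1) (b := 0) (by simp) false
    exact ⟨a, b, c, ha, by rw [this, h]⟩
  · rintro ⟨n, T, hT⟩
    have : ∀ i, ∃ e : ℂ ≃ᵢ ℂ, e '' thPentagon = T i := fun i => by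
      obtain ⟨a, b, c, ha, h⟩ := hT.tile i
      rw [h]
      exact exists_image_eq_tileSet ha b c
    choose f hf using this
    refine ⟨n, f, ?_, ?_⟩
    · intro i j hij
      simp only [hf]
      exact hT.disj hij
    · simp only [hf]
      exact hT.cover

/-- A similarity of ratio `s` preceded by scaling by `s⁻¹` is an isometry. The free centre `c`
allows both normal positions: a corner at 0 for the impossibility, the centre at 0 for the tilings.
-/
theorem exists_isometryEquiv_image {s : ℝ} (hs : 0 < s) {X : Set ℂ} (hX : IsHexagonalFlower s X)
    (c : ℂ) : ∃ e : ℂ ≃ᵢ ℂ, X = e '' {z | ((s⁻¹ : ℝ) : ℂ) * z - c ∈ region flowerTris} := by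
  obtain ⟨f, hf, rfl⟩ := hX
  have hg : Isometry fun z => f (((s⁻¹ : ℝ) : ℂ) * z - c + vC) := by
    apply Isometry.of_dist_eq
    intro x y
    rw [hf, dist_add_right, dist_sub_right, dist_eq_norm, ← mul_sub, norm_mul, norm_real,
      Real.norm_of_nonneg (inv_pos.mpr hs).le, mul_inv_cancel_left₀ hs.ne', ← dist_eq_norm]
  obtain ⟨e, he⟩ := exists_isometryEquiv hg
  have hsc : ((s⁻¹ : ℝ) : ℂ) * s = 1 := by exact_mod_cast inv_mul_cancel₀ hs.ne'
  refine ⟨e, Set.ext fun x => ⟨?_, ?_⟩⟩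
  · rintro ⟨w, hw, rfl⟩
    rw [mem_hfl1Unit] at hw
    have e1 : ((s⁻¹ : ℝ) : ℂ) * (s * (w - vC + c)) - c = w - vC := by
      linear_combination (w - vC + c) * hsc
    refine ⟨s * (w - vC + c), ?_, ?_⟩
    · rwa [Set.mem_ofPred_eq, e1]
    · rw [he, e1, sub_add_cancel]
  · rintro ⟨z, hz, rfl⟩
    refine ⟨((s⁻¹ : ℝ) : ℂ) * z - c + vC, ?_, (he z).symm⟩
    rw [mem_hfl1Unit, add_sub_cancel_right]
    exact hz

theorem not_filled {s : ℝ} (hs : 4 ≤ s) {X : Set ℂ} (hX : IsHexagonalFlower s X) :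
    ¬ FilledByTHPentagons X := by
  rw [filledByTHPentagons_iff]
  rintro ⟨n, T, hT⟩
  obtain ⟨e, rfl⟩ := exists_isometryEquiv_image (by linarith) hX (lat (-1) 3)
  have h := hT.image e.symm
  rw [Set.image_image] at h
  simp only [IsometryEquiv.symm_apply_apply, Set.image_id'] at h
  exact (flowerRegion_flower (by linarith)).not_isTiling hs h

/-- The lattice cells in a triangle with two sides on the axes. -/
theorem exists_cell {s : ℕ} (hs : 0 < s) {x y : ℝ} (hx : 0 ≤ x) (hy : 0 ≤ y) (h : x + y ≤ s) :
    ∃ i j : ℕ, (i : ℝ) ≤ x ∧ (j : ℝ) ≤ y ∧ ((i + j + 1 ≤ s ∧ x + y ≤ i + j + 1) ∨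
      (i + j + 2 ≤ s ∧ x ≤ i + 1 ∧ y ≤ j + 1 ∧ i + j + 1 ≤ x + y)) := by
  have hi := Nat.floor_le hx
  have hj := Nat.floor_le hy
  have hi' := (Nat.lt_floor_add_one x).le
  have hj' := (Nat.lt_floor_add_one y).le
  obtain ⟨i, ei⟩ : ∃ i, i = ⌊x⌋₊ := ⟨_, rfl⟩
  obtain ⟨j, ej⟩ : ∃ j, j = ⌊y⌋₊ := ⟨_, rfl⟩
  rw [← ei] at hi hi'
  rw [← ej] at hj hj'
  rcases Nat.lt_or_ge (i + j) s with hlt | hge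
  · refine ⟨i, j, hi, hj, ?_⟩
    rcases le_or_gt (x + y) (i + j + 1) with h1 | h1
    · exact Or.inl ⟨hlt, h1⟩
    · refine Or.inr ⟨?_, hi', hj', h1.le⟩
      have : (i + j + 1 : ℝ) < s := h1.trans_le h
      exact_mod_cast this
  -- Here `x + y = s` with integral coordinates, so the cell of the floors lies beyond the
  -- hypotenuse; a neighbouring cell contains the point on its boundary.
  · have hge' : (s : ℝ) ≤ i + j := by exact_mod_cast hge
    rcases i.eq_zero_or_pos with rfl | hp
    · push_cast at hi hge'
      have : ((s - 1 : ℕ) : ℝ) = s - 1 := by rw [Nat.cast_sub hs]; simp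
      refine ⟨0, s - 1, by simpa using hi, by rw [this]; linarith, Or.inl ⟨by omega, ?_⟩⟩
      rw [this]; push_cast; linarith
    · have e1 : ((i - 1 : ℕ) : ℝ) = i - 1 := by rw [Nat.cast_sub hp]; simp
      have e2 : ((i + j : ℕ) : ℝ) ≤ s := by push_cast; linarith
      have e3 : i + j ≤ s := by exact_mod_cast e2
      exact ⟨i - 1, j, by rw [e1]; linarith, hj, Or.inl ⟨by omega, by rw [e1]; linarith⟩⟩

theorem Tri.mem_sub {s : ℕ} (hs : 0 < s) (t : Tri) (z : ℂ) :
    (∃ t' ∈ t.sub s, z ∈ t'.set) ↔ (((s : ℝ)⁻¹ : ℝ) : ℂ) * z ∈ t.set := by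
  have hs' : (0 : ℝ) < s := by exact_mod_cast hs
  have hsc : ∀ x y : ℝ, (y ≤ (s : ℝ)⁻¹ * x ↔ s * y ≤ x) ∧ ((s : ℝ)⁻¹ * x ≤ y ↔ x ≤ s * y) :=
    fun x y => ⟨le_inv_mul_iff₀ hs', inv_mul_le_iff₀ hs'⟩
  obtain ⟨a, b, d⟩ := t
  cases d
  · have e : (((s : ℝ)⁻¹ : ℝ) : ℂ) * z ∈ (⟨a, b, false⟩ : Tri).set ↔
        s * b ≤ cv z ∧ s * a ≤ cu z ∧ cu z + cv z ≤ s * (a + b + 1 : ℝ) := by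
      rw [← (hsc _ _).1, ← (hsc _ _).1, ← (hsc _ _).2]
      rw [mul_add, ← cu_real_mul, ← cv_real_mul]
      generalize (((s : ℝ)⁻¹ : ℝ) : ℂ) * z = w
      simp [set, bary, Fin.forall_fin_succ]
    rw [e]
    constructor
    · rintro ⟨t', ht', hz⟩
      simp only [sub, List.mem_flatMap, List.mem_range, List.mem_append, List.mem_ite_nil_right,
        List.mem_singleton] at ht'
      obtain ⟨i, -, j, -, ⟨h, rfl⟩ | ⟨h, rfl⟩⟩ := ht'
      · have h : (i + j + 1 : ℝ) ≤ s := by exact_mod_cast h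
        simp [set, bary, Fin.forall_fin_succ] at hz
        have := i.cast_nonneg (α := ℝ)
        have := j.cast_nonneg (α := ℝ)
        obtain ⟨h1, h2, h3⟩ := hz
        refine ⟨?_, ?_, ?_⟩ <;> linarith
      · have h : (i + j + 2 : ℝ) ≤ s := by exact_mod_cast h
        simp [set, bary, Fin.forall_fin_succ] at hz
        have := i.cast_nonneg (α := ℝ)
        have := j.cast_nonneg (α := ℝ)
        obtain ⟨h1, h2, h3⟩ := hz
        refine ⟨?_, ?_, ?_⟩ <;> linarith
    · rintro ⟨h1, h2, h3⟩
      obtain ⟨i, j, hi, hj, h⟩ := exists_cell hs (x := cu z - s * a) (y := cv z - s * b)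
        (by linarith) (by linarith) (by linarith)
      simp only [sub, List.mem_flatMap, List.mem_range, List.mem_append, List.mem_ite_nil_right,
        List.mem_singleton]
      rcases h with ⟨h4, h5⟩ | ⟨h4, h5, h6, h7⟩
      · refine ⟨_, ⟨i, by omega, j, by omega, Or.inl ⟨h4, rfl⟩⟩, ?_⟩
        simp [set, bary, Fin.forall_fin_succ]
        refine ⟨?_, ?_, ?_⟩ <;> linarith
      · refine ⟨_, ⟨i, by omega, j, by omega, Or.inr ⟨h4, rfl⟩⟩, ?_⟩
        simp [set, bary, Fin.forall_fin_succ]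
        refine ⟨?_, ?_, ?_⟩ <;> linarith
  · have e : (((s : ℝ)⁻¹ : ℝ) : ℂ) * z ∈ (⟨a, b, true⟩ : Tri).set ↔
        cv z ≤ s * (b + 1 : ℝ) ∧ cu z ≤ s * (a + 1 : ℝ) ∧ s * (a + b + 1 : ℝ) ≤ cu z + cv z := by
      rw [← (hsc _ _).2, ← (hsc _ _).2, ← (hsc _ _).1]
      rw [mul_add, ← cu_real_mul, ← cv_real_mul]
      generalize (((s : ℝ)⁻¹ : ℝ) : ℂ) * z = w
      simp [set, bary, Fin.forall_fin_succ]
    rw [e]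
    constructor
    · rintro ⟨t', ht', hz⟩
      simp only [sub, List.mem_flatMap, List.mem_range, List.mem_append, List.mem_ite_nil_right,
        List.mem_singleton] at ht'
      obtain ⟨i, hi, j, hj, ⟨h, rfl⟩ | ⟨h, rfl⟩⟩ := ht'
      · have h : (s : ℝ) ≤ i + j + 1 := by exact_mod_cast h
        have hi : (i + 1 : ℝ) ≤ s := by exact_mod_cast hi
        have hj : (j + 1 : ℝ) ≤ s := by exact_mod_cast hj
        simp [set, bary, Fin.forall_fin_succ] at hz
        obtain ⟨h1, h2, h3⟩ := hz
        refine ⟨?_, ?_, ?_⟩ <;> linarith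
      · have h : (s : ℝ) ≤ i + j := by exact_mod_cast h
        have hi : (i + 1 : ℝ) ≤ s := by exact_mod_cast hi
        have hj : (j + 1 : ℝ) ≤ s := by exact_mod_cast hj
        simp [set, bary, Fin.forall_fin_succ] at hz
        obtain ⟨h1, h2, h3⟩ := hz
        refine ⟨?_, ?_, ?_⟩ <;> linarith
    · rintro ⟨h1, h2, h3⟩
      -- A downward triangle is measured from its corner `(a + 1, b + 1)`, which makes it look like
      -- an upward one; hence the indices `s - 1 - i` and `s - 1 - j` below.
      obtain ⟨i, j, hi, hj, h⟩ := exists_cell hs (x := s * (a + 1 : ℝ) - cu z)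
        (y := s * (b + 1 : ℝ) - cv z) (by linarith) (by linarith) (by linarith)
      simp only [sub, List.mem_flatMap, List.mem_range, List.mem_append, List.mem_ite_nil_right,
        List.mem_singleton]
      have hc : ∀ k, k + 1 ≤ s → ((s - 1 - k : ℕ) : ℝ) = s - 1 - k := fun k hk => by
        rw [Nat.cast_sub (by omega), Nat.cast_sub hs, Nat.cast_one]
      rcases h with ⟨h4, h5⟩ | ⟨h4, h5, h6, h7⟩
      · refine ⟨_, ⟨s - 1 - i, by omega, s - 1 - j, by omega, Or.inl ⟨by omega, rfl⟩⟩, ?_⟩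
        simp only [set, bary, Fin.forall_fin_succ]
        simp [hc i (by omega), hc j (by omega)]
        refine ⟨?_, ?_, ?_⟩ <;> linarith
      · refine ⟨_, ⟨s - 1 - i, by omega, s - 1 - j, by omega, Or.inr ⟨by omega, rfl⟩⟩, ?_⟩
        simp only [set, bary, Fin.forall_fin_succ]
        simp [hc i (by omega), hc j (by omega)]
        refine ⟨?_, ?_, ?_⟩ <;> linarith

theorem mem_region_scaledTris {s : ℕ} (hs : 0 < s) (z : ℂ) :
    z ∈ region (scaledTris s) ↔ (((s : ℝ)⁻¹ : ℝ) : ℂ) * z ∈ region flowerTris := by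
  constructor
  · rintro ⟨t', ht', hz⟩
    obtain ⟨t, ht, h⟩ := List.mem_flatMap.mp ht'
    exact ⟨t, ht, (Tri.mem_sub hs t z).mp ⟨t', h, hz⟩⟩
  · rintro ⟨t, ht, hz⟩
    obtain ⟨t', h, hz'⟩ := (Tri.mem_sub hs t z).mpr hz
    exact ⟨t', List.mem_flatMap.mpr ⟨t, ht, h⟩, hz'⟩

theorem filled_of_covers {s : ℕ} (hs : 0 < s) {Ts : List LatTile}
    (hc : covers Ts (scaledTris s) = true) (hn : (scaledTris s).Nodup)
    (hl : 7 * Ts.length = 3 * (scaledTris s).length) {X : Set ℂ} (hX : IsHexagonalFlower s X) :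
    FilledByTHPentagons X := by
  obtain ⟨e, rfl⟩ := exists_isometryEquiv_image (by exact_mod_cast hs) hX 0
  rw [filledByTHPentagons_iff]
  refine ⟨_, _, ((isTiling_of_covers hc hn hl).image e).congr ?_⟩
  congr 1
  ext z
  rw [mem_region_scaledTris hs, Set.mem_ofPred_eq, sub_zero]

end THTiling

theorem mainTheorem6 :
    (∀ s : ℝ, 4 ≤ s → ∀ X : Set ℂ, THTiling.IsHexagonalFlower s X →
      ¬ THTiling.FilledByTHPentagons X) ∧
    (∀ s : ℕ, s = 1 ∨ s = 2 ∨ s = 3 → ∀ X : Set ℂ, THTiling.IsHexagonalFlower (s : ℝ) X →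
      THTiling.FilledByTHPentagons X) := by
  refine ⟨fun s hs X hX => THTiling.not_filled hs hX, ?_⟩
  rintro s (rfl | rfl | rfl) X hX
  · exact THTiling.filled_of_covers one_pos THTiling.covers_one THTiling.nodup_scaledTris_one
      (by decide +kernel) hX
  · exact THTiling.filled_of_covers two_pos THTiling.covers_two THTiling.nodup_scaledTris_two
      (by decide +kernel) hX
  · exact THTiling.filled_of_covers three_pos THTiling.covers_three THTiling.nodup_scaledTris_three
      (by decide +kernel) hX
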